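/- Let $d\ge 0$ and $N\ge 2$ be integers and let $E\subset\mathbb{R}^d$ be a bounded Borel set of positive Lebesgue measure (for instance a compact set of positive measure). For a design $X=(x_1,\dots,x_N)\in(\mathbb{R}^d)^N$ put $\delta_X=\min_{i\ne j}\|x_i-x_j\|$ (Euclidean norm) and $U(X)=\operatorname{diam}(E)-\delta_X$. Let $\operatorname{osc}(U)$ be the smallest $h\ge 0$ such that $U(Y)-U(X)\le h$ for all $X,Y\in E^N$. Let $\lambda_N$ be Lebesgue measure restricted to $E^N$, let $m=\sup\{a\in\mathbb{R}:\lambda_N(\{X: U(X)<a\})=0\}$ and, for $\varepsilon>0$, let $U^\varepsilon=\{X\in E^N: U(X)\le m+\varepsilon\}$. Fix $\gamma>0$ and a symmetric positive definite $d\times d$ matrix $\Sigma$. Let $d^X_{i,j}=1/(\|x_i-x_j\|+\gamma)$ and $D^X=\sum_{k<l}d^X_{k,l}$, let $\phi(\cdot\,|\,\mu,S)$ be the density of the Gaussian law $\mathcal N_d(\mu,S)$, and let $$\tilde q_{\tau,k}(X,Y)=\phi(y_k\,|\,x_k,\tau\Sigma)\sum_{j\ne k}\frac12\,\frac{d^X_{k,j}}{D^X}.$$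 Given sequences $(\beta_n)_{n\ge0}$ and $(\tau_n)_{n\ge 0}$ of real numbers, with $\tau_n>0$, and a probability distribution $\eta$ on $E^N$, let $(X^{(n)})_{n\ge 0}$ be the random sequence such that $X^{(0)}$ has law $\eta$ and $X^{(n+1)}$ is produced from $X=X^{(n)}$ by the following iteration, with $\beta=\beta_n$, $\tau=\tau_n$ and fresh independent draws: 1. draw a pair of indices $i<j$ with probability $d^X_{i,j}/D^X$; 2. choose one of the two indices with probability $1/2$ and call it $k$; 3. draw $x_k^{prop}\sim\mathcal N_d(x_k,\tau\Sigma)$, not constrained to $E$, and let $X^{prop}$ be $X$ with $x_k$ replaced by $x_k^{prop}$; 4. if $X^{prop}\in E^N$, set $X^{(n+1)}=X^{prop}$ with probability $$\min\left(1,\;e^{-\beta\,(U(X^{prop})-U(X))}\,\frac{\tilde q_{\tau,k}(X^{prop},X)}{\tilde q_{\tau,k}(X,X^{prop})}\right);$$ otherwise (rejection, or $X^{prop}\notin E^N$) set $X^{(n+1)}=X$. Let $\mathbb P_\eta$ be the law of this sequence. Suppose that $\tau_0\ge\tau_n\ge\tau_{min}$ for all $n\ge 0$, for some $\tau_{min}>0$,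 and that $\beta_n=\frac1C\log(n+e)$ for all $n\ge 0$, where $C>N\operatorname{osc}(U)$. Then $$\forall\varepsilon>0,\qquad \lim_{n\to\infty}\mathbb P_\eta\big(X^{(n)}\in U^\varepsilon\big)=1 .$$ -/

import Mathlib

open MeasureTheory ProbabilityTheory Filter Topology

namespace MaximinAnnealing

/-- Points of `ℝ^d`, with the Euclidean norm and Lebesgue measure. -/
abbrev Point (d : ℕ) : Type := EuclideanSpace ℝ (Fin d)

/-- Ordered `N`-tuples of points of `ℝ^d`; `volume` on this type is Lebesgue measure
on `(ℝ^d)^N`. -/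
abbrev Design (d N : ℕ) : Type := Fin N → Point d

/-- The set `E^N` of designs all of whose points lie in `E`. -/
def designsIn {d : ℕ} (N : ℕ) (E : Set (Point d)) : Set (Design d N) :=
  {X | ∀ i, X i ∈ E}

/-- `δ_X`, the minimal distance between two points of `X` with different indices. -/
noncomputable def separation {d N : ℕ} (X : Design d N) : ℝ :=
  ⨅ p : {p : Fin N × Fin N // p.1 ≠ p.2}, ‖X p.1.1 - X p.1.2‖

/-- `U(X) = diam(E) - δ_X`. -/
noncomputable def energy {d N : ℕ} (E : Set (Point d)) (X : Design d N) : ℝ :=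
  Metric.diam E - separation X

/-- `osc(U)`: the least `h ≥ 0` such that `U(Y) - U(X) ≤ h` for all `X, Y` in `E^N`. -/
noncomputable def osc {d : ℕ} (N : ℕ) (E : Set (Point d)) : ℝ :=
  sInf {h : ℝ | 0 ≤ h ∧
    ∀ X ∈ designsIn N E, ∀ Y ∈ designsIn N E, energy E Y - energy E X ≤ h}

/-- `m = sup {a : λ_N {X ; U(X) < a} = 0}`, where `λ_N` is Lebesgue measure on `E^N`. -/
noncomputable def essMin {d : ℕ} (N : ℕ) (E : Set (Point d)) : ℝ :=
  sSup {a : ℝ |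
    (volume.restrict (designsIn N E)) {X : Design d N | energy E X < a} = 0}

/-- `U^ε = {X ∈ E^N ; U(X) ≤ m + ε}`. -/
def nearOptimal {d : ℕ} (N : ℕ) (E : Set (Point d)) (ε : ℝ) : Set (Design d N) :=
  {X | X ∈ designsIn N E ∧ energy E X ≤ essMin N E + ε}

/-- `d_{i,j}^X = 1 / (‖x_i - x_j‖ + γ)`. -/
noncomputable def pairWeight {d N : ℕ} (γ : ℝ) (X : Design d N) (i j : Fin N) : ℝ :=
  1 / (‖X i - X j‖ + γ)

/-- Pairs of indices `k < l`. -/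
abbrev Pair (N : ℕ) : Type := {p : Fin N × Fin N // p.1 < p.2}

/-- `D^X`, the sum of `d_{k,l}^X` over `k < l`. -/
noncomputable def totalWeight {d N : ℕ} (γ : ℝ) (X : Design d N) : ℝ :=
  ∑ p : Pair N, pairWeight γ X p.1.1 p.1.2

/-- `φ(y | μ, S)`, the density of the Gaussian law on `ℝ^d` with mean `μ` and covariance
matrix `S`. -/
noncomputable def gaussianDensity {d : ℕ} (μ : Point d) (S : Matrix (Fin d) (Fin d) ℝ)
    (y : Point d) : ℝ :=
  (Real.sqrt ((2 * Real.pi) ^ d * S.det))⁻¹ *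
    Real.exp (-(1 / 2) *
      ((fun i => y i - μ i) ⬝ᵥ S⁻¹.mulVec (fun i => y i - μ i)))

/-- The (unconstrained) proposal density for moving the point of index `k`:
`φ(y_k | x_k, τ V) * ∑_{j ≠ k} (1/2) d_{k,j}^X / D^X`. -/
noncomputable def proposalDensity {d N : ℕ} (γ : ℝ) (V : Matrix (Fin d) (Fin d) ℝ) (τ : ℝ)
    (k : Fin N) (X Y : Design d N) : ℝ :=
  gaussianDensity (X k) (τ • V) (Y k) *
    ∑ j ∈ Finset.univ.filter (fun j => j ≠ k),
      1 / 2 * (pairWeight γ X k j / totalWeight γ X)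

/-- The probability of accepting the proposed design `Y` from the current design `X`, when the
point of index `k` is moved. -/
noncomputable def acceptProb {d N : ℕ} (E : Set (Point d)) (γ : ℝ)
    (V : Matrix (Fin d) (Fin d) ℝ) (β τ : ℝ) (k : Fin N) (X Y : Design d N) : ℝ :=
  min 1 (Real.exp (-β * (energy E Y - energy E X)) *
    (proposalDensity γ V τ k Y X / proposalDensity γ V τ k X Y))

section Measurability

variable {d N : ℕ}

theorem measurableSet_designsIn {E : Set (Point d)} (hE : MeasurableSet E) :
    MeasurableSet (designsIn N E) := by
  have : designsIn N E = ⋂ i, (fun X : Design d N => X i) ⁻¹' E := by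
    ext X; simp [designsIn]
  rw [this]
  exact MeasurableSet.iInter fun i => measurable_pi_apply i hE

theorem measurable_separation : Measurable (separation : Design d N → ℝ) := by
  unfold separation
  exact Measurable.iInf fun p =>
    ((measurable_pi_apply p.1.1).sub (measurable_pi_apply p.1.2)).norm

theorem measurable_energy (E : Set (Point d)) :
    Measurable (energy E : Design d N → ℝ) :=
  measurable_separation.const_sub _

theorem measurable_pairWeight (γ : ℝ) (i j : Fin N) :
    Measurable (fun X : Design d N => pairWeight γ X i j) := by
  unfold pairWeight
  exact ((((measurable_pi_apply i).sub (measurable_pi_apply j)).norm).add_const γ).const_div 1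

theorem measurable_totalWeight (γ : ℝ) :
    Measurable (fun X : Design d N => totalWeight γ X) := by
  unfold totalWeight
  exact Finset.measurable_sum _ fun p _ => measurable_pairWeight γ p.1.1 p.1.2

theorem measurable_proposalDensity (γ : ℝ) (V : Matrix (Fin d) (Fin d) ℝ) (τ : ℝ) (k : Fin N) :
    Measurable (fun z : Design d N × Design d N => proposalDensity γ V τ k z.1 z.2) := by
  unfold proposalDensity
  refine Measurable.mul ?_ ?_
  · unfold gaussianDensity
    simp only [dotProduct, Matrix.mulVec]
    fun_prop
  · refine Finset.measurable_sum _ fun j _ => ?_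
    exact ((((measurable_pairWeight γ k j).div (measurable_totalWeight γ)).const_mul _).comp
      measurable_fst)

theorem measurable_acceptProb (E : Set (Point d)) (γ : ℝ) (V : Matrix (Fin d) (Fin d) ℝ)
    (β τ : ℝ) (k : Fin N) :
    Measurable (fun z : Design d N × Design d N => acceptProb E γ V β τ k z.1 z.2) := by
  unfold acceptProb
  have h1 := measurable_proposalDensity (d := d) (N := N) γ V τ k
  have h2 := h1.comp measurable_swap
  have h3 := (measurable_energy (N := N) E)
  exact measurable_const.min (((((h3.comp measurable_snd).sub
    (h3.comp measurable_fst)).const_mul (-β)).exp).mul (h2.div h1))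

end Measurability

section Nonnegativity

variable {d N : ℕ}

theorem pairWeight_pos {γ : ℝ} (hγ : 0 < γ) (X : Design d N) (i j : Fin N) :
    0 < pairWeight γ X i j := by
  unfold pairWeight; positivity

theorem totalWeight_pos (hN : 2 ≤ N) {γ : ℝ} (hγ : 0 < γ) (X : Design d N) :
    0 < totalWeight γ X := by
  have : Nonempty (Pair N) :=
    ⟨⟨(⟨0, by omega⟩, ⟨1, by omega⟩), by simp⟩⟩
  exact Finset.sum_pos (fun p _ => pairWeight_pos hγ X _ _) Finset.univ_nonempty

theorem totalWeight_nonneg {γ : ℝ} (hγ : 0 < γ) (X : Design d N) : 0 ≤ totalWeight γ X :=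
  Finset.sum_nonneg fun _ _ => (pairWeight_pos hγ X _ _).le

theorem proposalDensity_nonneg {γ : ℝ} (hγ : 0 < γ) (V : Matrix (Fin d) (Fin d) ℝ) (τ : ℝ)
    (k : Fin N) (X Y : Design d N) : 0 ≤ proposalDensity γ V τ k X Y := by
  unfold proposalDensity gaussianDensity
  refine mul_nonneg (by positivity) (Finset.sum_nonneg fun j _ => ?_)
  exact mul_nonneg (by norm_num) (div_nonneg (pairWeight_pos hγ X _ _).le
    (totalWeight_nonneg hγ X))

theorem acceptProb_nonneg (E : Set (Point d)) {γ : ℝ} (hγ : 0 < γ)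
    (V : Matrix (Fin d) (Fin d) ℝ) (β τ : ℝ) (k : Fin N) (X Y : Design d N) :
    0 ≤ acceptProb E γ V β τ k X Y :=
  le_min zero_le_one (mul_nonneg (Real.exp_pos _).le
    (div_nonneg (proposalDensity_nonneg hγ V τ k Y X) (proposalDensity_nonneg hγ V τ k X Y)))

theorem acceptProb_le_one (E : Set (Point d)) (γ : ℝ)
    (V : Matrix (Fin d) (Fin d) ℝ) (β τ : ℝ) (k : Fin N) (X Y : Design d N) :
    acceptProb E γ V β τ k X Y ≤ 1 :=
  min_le_left _ _

end Nonnegativity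

/-- The draw of a pair of points of `X`, with probability `d_{k,l}^X / D^X` for the
pair `k < l`. -/
noncomputable def pairLaw {d N : ℕ} (hN : 2 ≤ N) {γ : ℝ} (hγ : 0 < γ) (X : Design d N) :
    PMF (Pair N) :=
  PMF.ofFintype
    (fun p => ENNReal.ofReal (pairWeight γ X p.1.1 p.1.2 / totalWeight γ X)) (by
      have hD := totalWeight_pos hN hγ X
      rw [← ENNReal.ofReal_sum_of_nonneg
        (fun p _ => div_nonneg (pairWeight_pos hγ X _ _).le hD.le), ← Finset.sum_div]
      change ENNReal.ofReal (totalWeight γ X / totalWeight γ X) = 1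
      rw [div_self hD.ne', ENNReal.ofReal_one])

/-- The proposal when the point of index `k` is moved: `x_k` is replaced by a point drawn from
the Gaussian law `𝒩_d(x_k, τ V)`, which may fall outside `E`. -/
noncomputable def proposal {d N : ℕ} (V : Matrix (Fin d) (Fin d) ℝ) (τ : ℝ) (k : Fin N) :
    Kernel (Design d N) (Design d N) where
  toFun X := (multivariateGaussian (X k) (τ • V)).map (Function.update X k)
  measurable' := by
    have key : ∀ L : Point d →L[ℝ] Point d, Measurable (fun X : Design d N =>
        ((stdGaussian (Point d)).map (fun x => X k + L x)).map (Function.update X k)) := by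
      intro L
      have hf : Measurable (fun z : Design d N × Point d =>
          Function.update z.1 k (z.1 k + L z.2)) := by
        refine measurable_pi_iff.2 fun i => ?_
        by_cases h : i = k
        · subst h
          simp only [Function.update_self]
          fun_prop
        · simp only [Function.update_of_ne h]
          fun_prop
      have := ((Kernel.id ×ₖ Kernel.const (Design d N) (stdGaussian (Point d))).map
        (fun z : Design d N × Point d => Function.update z.1 k (z.1 k + L z.2))).measurable
      convert this using 2 with X
      rw [Kernel.map_apply _ hf, Kernel.prod_apply, Kernel.id_apply, Kernel.const_apply,
        Measure.dirac_prod, Measure.map_map hf (by fun_prop),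
        Measure.map_map (measurable_update X) (by fun_prop)]
      rfl
    exact key _

instance {d N : ℕ} (V : Matrix (Fin d) (Fin d) ℝ) (τ : ℝ) (k : Fin N) :
    IsMarkovKernel (proposal V τ k) :=
  ⟨fun X => Measure.isProbabilityMeasure_map (measurable_update X).aemeasurable⟩

open Classical in
/-- Acceptance step for a current design `z.1` and a proposed design `z.2`: if the proposed design
lies in `E^N`, it becomes the new state with probability `acceptProb`; in all other cases the state
does not change. -/
noncomputable def acceptReject {d N : ℕ} {E : Set (Point d)} (hE : MeasurableSet E) (γ : ℝ)
    (V : Matrix (Fin d) (Fin d) ℝ) (β τ : ℝ) (k : Fin N) :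
    Kernel (Design d N × Design d N) (Design d N) where
  toFun z :=
    if z.2 ∈ designsIn N E then
      ENNReal.ofReal (acceptProb E γ V β τ k z.1 z.2) • Measure.dirac z.2 +
        ENNReal.ofReal (1 - acceptProb E γ V β τ k z.1 z.2) • Measure.dirac z.1
    else Measure.dirac z.1
  measurable' := by
    have ha := measurable_acceptProb E γ V β τ k
    refine Measurable.ite (measurable_snd (measurableSet_designsIn hE)) ?_
      (Measure.measurable_dirac.comp measurable_fst)
    refine Measure.measurable_of_measurable_coe _ fun s hs => ?_
    simp only [Measure.add_apply, Measure.smul_apply, smul_eq_mul]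
    exact (ha.ennreal_ofReal.mul
      ((Measure.measurable_coe hs).comp (Measure.measurable_dirac.comp measurable_snd))).add
      ((ha.const_sub 1).ennreal_ofReal.mul
      ((Measure.measurable_coe hs).comp (Measure.measurable_dirac.comp measurable_fst)))

/-- Moving the point of index `k`: proposal, then acceptance or rejection. -/
noncomputable def move {d N : ℕ} {E : Set (Point d)} (hE : MeasurableSet E) (γ : ℝ)
    (V : Matrix (Fin d) (Fin d) ℝ) (β τ : ℝ) (k : Fin N) :
    Kernel (Design d N) (Design d N) :=
  acceptReject hE γ V β τ k ∘ₖ (Kernel.id ×ₖ proposal V τ k)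

theorem isMarkovKernel_move {d N : ℕ} {E : Set (Point d)} (hE : MeasurableSet E) {γ : ℝ}
    (hγ : 0 < γ) (V : Matrix (Fin d) (Fin d) ℝ) (β τ : ℝ) (k : Fin N) :
    IsMarkovKernel (move hE γ V β τ k) := by
  have : IsMarkovKernel (acceptReject hE γ V β τ k) := by
    refine ⟨fun z => ⟨?_⟩⟩
    by_cases h : z.2 ∈ designsIn N E
    · rw [show acceptReject hE γ V β τ k z = _ from if_pos h]
      simp only [Measure.add_apply, Measure.smul_apply, smul_eq_mul, measure_univ, mul_one]
      rw [← ENNReal.ofReal_add (acceptProb_nonneg E hγ V β τ k _ _)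
        (sub_nonneg.2 (acceptProb_le_one E γ V β τ k _ _))]
      simp
    · rw [show acceptReject hE γ V β τ k z = _ from if_neg h]
      exact measure_univ
  unfold move
  infer_instance

/-- One iteration of the algorithm, at inverse temperature `β` and variance parameter `τ`: draw a
pair of points, choose one of the two with probability `1/2`, and move it. -/
noncomputable def stepKernel {d N : ℕ} (hN : 2 ≤ N) {E : Set (Point d)} (hE : MeasurableSet E)
    {γ : ℝ} (hγ : 0 < γ) (V : Matrix (Fin d) (Fin d) ℝ) (β τ : ℝ) :
    Kernel (Design d N) (Design d N) where
  toFun X := ∑ p : Pair N, pairLaw hN hγ X p •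
    ((2⁻¹ : ENNReal) • move hE γ V β τ p.1.1 X + (2⁻¹ : ENNReal) • move hE γ V β τ p.1.2 X)
  measurable' := by
    refine Measure.measurable_of_measurable_coe _ fun s hs => ?_
    simp only [Measure.finsetSum_apply, Measure.add_apply, Measure.smul_apply, smul_eq_mul,
      pairLaw, PMF.ofFintype_apply]
    refine Finset.measurable_sum _ fun p _ => ?_
    refine (((measurable_pairWeight γ p.1.1 p.1.2).div
      (measurable_totalWeight γ)).ennreal_ofReal).mul ?_
    exact (((move hE γ V β τ p.1.1).measurable_coe hs).const_mul _).add
      (((move hE γ V β τ p.1.2).measurable_coe hs).const_mul _)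

instance isMarkovKernel_stepKernel {d N : ℕ} (hN : 2 ≤ N) {E : Set (Point d)}
    (hE : MeasurableSet E) {γ : ℝ} (hγ : 0 < γ) (V : Matrix (Fin d) (Fin d) ℝ) (β τ : ℝ) :
    IsMarkovKernel (stepKernel hN hE hγ V β τ) := by
  refine ⟨fun X => ⟨?_⟩⟩
  have := fun k : Fin N => isMarkovKernel_move hE hγ V β τ k
  change (∑ p : Pair N, pairLaw hN hγ X p •
    ((2⁻¹ : ENNReal) • move hE γ V β τ p.1.1 X +
      (2⁻¹ : ENNReal) • move hE γ V β τ p.1.2 X)) Set.univ = 1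
  simp only [Measure.finsetSum_apply, Measure.add_apply, Measure.smul_apply, smul_eq_mul,
    measure_univ, mul_one, ENNReal.inv_two_add_inv_two]
  rw [← tsum_fintype (L := .unconditional _)]
  exact (pairLaw hN hγ X).tsum_coe

/-- The law `ℙ_η` of the whole random sequence `(X^(n))_{n ≥ 0}` produced by the algorithm:
`X^(0)` has law `η`, and `X^(n+1)` is obtained from `X^(n)` by one iteration with parameters
`β n` and `τ n`, the iterations being driven by independent draws. -/
noncomputable def sequenceLaw {d N : ℕ} (hN : 2 ≤ N) {E : Set (Point d)} (hE : MeasurableSet E)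
    {γ : ℝ} (hγ : 0 < γ) (V : Matrix (Fin d) (Fin d) ℝ) (β τ : ℕ → ℝ)
    (η : Measure (Design d N)) : Measure (ℕ → Design d N) :=
  Kernel.trajMeasure (X := fun _ => Design d N) η fun n =>
    (stepKernel hN hE hγ V (β n) (τ n)).comap
      (fun x : (i : Finset.Iic n) → Design d N => x ⟨n, Finset.mem_Iic.2 le_rfl⟩)
      (measurable_pi_apply _)

end MaximinAnnealing

/-! For fixed `β`, the Gibbs law proportional to `e^{-βU}` on `E^N` is invariant under one
iteration: the Gaussian displacement is symmetric, and the acceptance ratio contains the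
probabilities `moveProb` of selecting the moved index, so detailed balance holds for each index
(`gibbsMeasure_bind_stepKernel`). As `β → ∞` these laws concentrate on the near-optimal designs
(`tendsto_gibbsLaw_compl_nearOptimal`). It remains to see that the chain follows them.

Two effects compete over a block of `N` iterations. Moving each of the `N` points once, with every
move accepted, reaches all of `E^N`; since an accepted move costs at most a factor of order `e^{-β
osc(U)}`, the block kernel dominates a measure independent of the starting design, of mass `κ e^{-Nβ
osc(U)}` (`exists_minorization_rate`). Meanwhile the target drifts: `gibbsLaw_le_smul` bounds the
change of Gibbs law by `exp((β' - β) osc(U))`.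

Closeness is measured by the mass of a common minorant (`HasOverlap`) with defect `t`. A block turns
`t` into `(1 - e) t + s` (`HasOverlap.bind`). With `β_n = log(n + e)/C` and `a = N osc(U)/C < 1`,
the gain is of order `n^{-a}`, whose sum over blocks diverges, and the drift is at most `a/(n + e)`,
of smaller order. Hence the defect tends to `0` (`tendsto_zero_of_contraction`) along each residue
class modulo `N`, hence along all times. -/

namespace MaximinAnnealing

/-! ### Scalar recursions and residue classes. -/

section Recursion

/-- Once `s ≤ (δ/2) e`, the excess `u - δ/2` is multiplied by at most `1 - e ≤ exp(-e)` at each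
step, and the divergent sum drives the product of these factors to `0`. -/
theorem tendsto_zero_of_contraction {u e s : ℕ → ℝ} (hu : ∀ k, 0 ≤ u k)
    (he1 : ∀ k, e k ≤ 1) (hrec : ∀ k, u (k + 1) ≤ (1 - e k) * u k + s k)
    (hsum : Tendsto (fun k => ∑ i ∈ Finset.range k, e i) atTop atTop)
    (hs : ∀ δ : ℝ, 0 < δ → ∀ᶠ k in atTop, s k ≤ δ * e k) :
    Tendsto u atTop (𝓝 0) := by
  rw [Metric.tendsto_atTop]
  intro δ hδ
  obtain ⟨K, hK⟩ := eventually_atTop.1 (hs (δ / 2) (by positivity))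
  have key : ∀ j, u (K + j) - δ / 2 ≤
      |u K - δ / 2| * Real.exp (-∑ i ∈ Finset.range j, e (K + i)) := by
    intro j
    induction j with
    | zero => simpa using le_abs_self (u K - δ / 2)
    | succ j ih =>
      have h1 := hrec (K + j)
      have h2 := hK (K + j) (by omega)
      have h3 := he1 (K + j)
      have h4 : 1 - e (K + j) ≤ Real.exp (-e (K + j)) := by
        have := Real.add_one_le_exp (-e (K + j)); linarith
      calc u (K + (j + 1)) - δ / 2
          ≤ (1 - e (K + j)) * (u (K + j) - δ / 2) := by
            rw [← add_assoc]; linarith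
        _ ≤ (1 - e (K + j)) *
            (|u K - δ / 2| * Real.exp (-∑ i ∈ Finset.range j, e (K + i))) :=
            mul_le_mul_of_nonneg_left ih (by linarith)
        _ ≤ Real.exp (-e (K + j)) *
            (|u K - δ / 2| * Real.exp (-∑ i ∈ Finset.range j, e (K + i))) :=
            mul_le_mul_of_nonneg_right h4 (by positivity)
        _ = _ := by
            rw [Finset.sum_range_succ, neg_add, Real.exp_add]; ring
  have hsum' : Tendsto (fun j => ∑ i ∈ Finset.range j, e (K + i)) atTop atTop := by
    have h := tendsto_atTop_add_const_right atTop (-∑ i ∈ Finset.range K, e i)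
      ((tendsto_add_atTop_iff_nat K).2 hsum)
    refine h.congr fun j => ?_
    rw [add_comm j K, Finset.sum_range_add]; ring
  have hlim : Tendsto (fun j => |u K - δ / 2| *
      Real.exp (-∑ i ∈ Finset.range j, e (K + i))) atTop (𝓝 0) := by
    simpa using (Real.tendsto_exp_neg_atTop_nhds_zero.comp hsum').const_mul |u K - δ / 2|
  obtain ⟨J, hJ⟩ := eventually_atTop.1 (hlim.eventually (gt_mem_nhds (half_pos hδ)))
  refine ⟨K + J, fun n hn => ?_⟩
  obtain ⟨j, rfl⟩ := Nat.exists_eq_add_of_le (le_trans (Nat.le_add_right K J) hn)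
  rw [Real.dist_0_eq_abs, abs_of_nonneg (hu _)]
  have := key j
  have := hJ j (by omega)
  linarith

theorem tendsto_of_tendsto_residues {α : Type*} {l : Filter α} {f : ℕ → α} {N : ℕ} (hN : 0 < N)
    (h : ∀ r < N, Tendsto (fun k => f (r + k * N)) atTop l) : Tendsto f atTop l := by
  intro s hs
  choose! K hK using fun r (hr : r < N) => eventually_atTop.1 (h r hr hs)
  refine eventually_atTop.2 ⟨(∑ r ∈ Finset.range N, K r) * N, fun n hn => ?_⟩
  have hr := Nat.mod_lt n hN
  have h1 : K (n % N) ≤ n / N := by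
    refine le_trans ?_ ((Nat.le_div_iff_mul_le hN).2 hn)
    exact Finset.single_le_sum (f := K) (fun _ _ => Nat.zero_le _) (Finset.mem_range.2 hr)
  have h2 := hK (n % N) hr (n / N) h1
  simpa only [mul_comm _ N, Nat.mod_add_div] using h2

end Recursion

/-! ### Common minorants of two measures under a Markov kernel. -/

section Overlap

variable {α : Type*} [MeasurableSpace α]

/-- The measures `μ` and `π` dominate a common measure of mass at least `1 - t`. -/
def HasOverlap (μ π : Measure α) (t : ℝ) : Prop :=
  ∃ σ : Measure α, σ ≤ μ ∧ σ ≤ π ∧ ENNReal.ofReal (1 - t) ≤ σ Set.univ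

theorem hasOverlap_one (μ π : Measure α) : HasOverlap μ π 1 :=
  ⟨0, Measure.zero_le _, Measure.zero_le _, by simp⟩

/-- Split `μ = σ + (μ - σ)`. The remainder has mass `1 - σ univ` and is carried by `S`, where every
starting point contributes at least `ρ`. -/
theorem bind_add_smul_le {σ μ ρ : Measure α} [IsProbabilityMeasure μ] (hσ : σ ≤ μ)
    (K : Kernel α α) {S : Set α} (hS : ∀ᵐ x ∂μ, x ∈ S) (hρ : ∀ x ∈ S, ρ ≤ K x) :
    σ.bind K + (1 - σ Set.univ) • ρ ≤ μ.bind K := by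
  have : IsFiniteMeasure σ := isFiniteMeasure_of_le μ hσ
  have hsub : μ - σ + σ = μ := Measure.sub_add_cancel_of_le hσ
  refine Measure.le_iff.2 fun A hA => ?_
  have hac : ∀ᵐ x ∂(μ - σ), x ∈ S := (Measure.absolutelyContinuous_of_le Measure.sub_le) hS
  have h1 : (1 - σ Set.univ) * ρ A ≤ ∫⁻ x, K x A ∂(μ - σ) := by
    calc (1 - σ Set.univ) * ρ A = ∫⁻ _, ρ A ∂(μ - σ) := by
          rw [lintegral_const, Measure.sub_apply MeasurableSet.univ hσ,
            measure_univ (μ := μ), mul_comm]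
      _ ≤ _ := lintegral_mono_ae (hac.mono fun x hx => hρ x hx A)
  rw [Measure.add_apply, Measure.smul_apply, smul_eq_mul,
    Measure.bind_apply hA K.aemeasurable, Measure.bind_apply hA K.aemeasurable]
  conv_rhs => rw [← hsub, lintegral_add_measure]
  rw [add_comm]
  gcongr

/-- Both images dominate the same measure `σK + (1 - m)ρ`, where `m` is the mass of `σ`. Its mass is
at least `m + (1 - m)e ≥ 1 - (1 - e)t`. Passing from `πK` to `π'` costs a factor `e^{-s}`. -/
theorem HasOverlap.bind {μ π π' ρ : Measure α} [IsProbabilityMeasure μ] [IsProbabilityMeasure π]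
    {t : ℝ} (h : HasOverlap μ π t) (K : Kernel α α) [IsMarkovKernel K]
    {S : Set α} (hμ : ∀ᵐ x ∂μ, x ∈ S) (hπ : ∀ᵐ x ∂π, x ∈ S) (hρ : ∀ x ∈ S, ρ ≤ K x)
    {e : ℝ} (he0 : 0 ≤ e) (he1 : e ≤ 1) (he : ENNReal.ofReal e ≤ ρ Set.univ)
    {s : ℝ} (hs : 0 ≤ s) (hπ' : π.bind K ≤ ENNReal.ofReal (Real.exp s) • π') :
    HasOverlap (μ.bind K) π' ((1 - e) * t + s) := by
  obtain ⟨σ, h1, h2, h3⟩ := h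
  have : IsFiniteMeasure σ := isFiniteMeasure_of_le μ h1
  have hμ' := bind_add_smul_le h1 K hμ hρ
  have hπ'' := bind_add_smul_le h2 K hπ hρ
  set σ' := σ.bind K + (1 - σ Set.univ) • ρ with hσ'
  have hinv : ENNReal.ofReal (Real.exp (-s)) * ENNReal.ofReal (Real.exp s) = 1 := by
    rw [← ENNReal.ofReal_mul (Real.exp_pos _).le, ← Real.exp_add]; simp
  refine ⟨ENNReal.ofReal (Real.exp (-s)) • σ', ?_, ?_, ?_⟩
  · refine le_trans ?_ hμ'
    refine Measure.le_iff.2 fun A _ => ?_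
    rw [Measure.smul_apply, smul_eq_mul]
    refine mul_le_of_le_one_left' ?_
    rw [← ENNReal.ofReal_one]
    exact ENNReal.ofReal_le_ofReal (Real.exp_le_one_iff.2 (by linarith))
  · refine Measure.le_iff.2 fun A _ => ?_
    rw [Measure.smul_apply, smul_eq_mul]
    calc _ ≤ ENNReal.ofReal (Real.exp (-s)) * (ENNReal.ofReal (Real.exp s) * π' A) := by
          gcongr
          exact (hπ'' A).trans (hπ' A)
      _ = π' A := by rw [← mul_assoc, hinv, one_mul]
  · have hm1 : σ Set.univ ≤ 1 := (h1 _).trans_eq measure_univ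
    have hm : σ Set.univ ≠ ⊤ := measure_ne_top _ _
    set m := (σ Set.univ).toReal with hmdef
    have hmm : σ Set.univ = ENNReal.ofReal m := (ENNReal.ofReal_toReal hm).symm
    have hm0 : 0 ≤ m := ENNReal.toReal_nonneg
    have hmle : m ≤ 1 := by
      rw [hmdef]; exact ENNReal.toReal_le_of_le_ofReal zero_le_one (by simpa using hm1)
    have hmt : 1 - t ≤ m := by
      rw [hmm] at h3
      exact (ENNReal.ofReal_le_ofReal_iff hm0).1 h3
    have hmass : ENNReal.ofReal (m + (1 - m) * e) ≤ σ' Set.univ := by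
      rw [hσ', Measure.add_apply, Measure.smul_apply, smul_eq_mul,
        Measure.bind_apply MeasurableSet.univ K.aemeasurable]
      simp only [measure_univ, lintegral_const, one_mul]
      rw [hmm, ENNReal.ofReal_add hm0 (mul_nonneg (by linarith) he0),
        ENNReal.ofReal_mul (by linarith), ENNReal.ofReal_sub _ hm0, ENNReal.ofReal_one]
      gcongr
    rw [Measure.smul_apply, smul_eq_mul]
    calc ENNReal.ofReal (1 - ((1 - e) * t + s))
        ≤ ENNReal.ofReal (Real.exp (-s) * (m + (1 - m) * e)) := by
          refine ENNReal.ofReal_le_ofReal ?_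
          have h5 : 1 - s ≤ Real.exp (-s) := by
            have := Real.add_one_le_exp (-s); linarith
          have h6 : 0 ≤ m + (1 - m) * e := by
            have := mul_nonneg (sub_nonneg.2 hmle) he0
            linarith
          have h7 : m + (1 - m) * e ≤ 1 := by nlinarith
          have h8 : 1 - (1 - e) * t ≤ m + (1 - m) * e := by nlinarith
          -- For a mass `M ≤ 1`, `e^{-s} M ≥ (1 - s) M ≥ M - s`.
          nlinarith
      _ ≤ _ := by
          rw [ENNReal.ofReal_mul (Real.exp_pos _).le]
          gcongr

theorem HasOverlap.le_measure {μ π : Measure α} [IsProbabilityMeasure π] {t : ℝ}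
    (h : HasOverlap μ π t) (A : Set α) (hA : MeasurableSet A) :
    ENNReal.ofReal (1 - t) - π Aᶜ ≤ μ A := by
  obtain ⟨σ, h1, h2, h3⟩ := h
  have : IsFiniteMeasure σ := isFiniteMeasure_of_le π h2
  rw [tsub_le_iff_right]
  calc _ ≤ σ Set.univ := h3
    _ = σ A + σ Aᶜ := (measure_add_measure_compl hA).symm
    _ ≤ _ := add_le_add (h1 A) (h2 _)

end Overlap

/-! ### Gaussian laws dominate a multiple of Lebesgue measure on bounded sets. -/

section Gaussian

open scoped MatrixOrder

theorem stdGaussian_map_neg {F : Type*} [NormedAddCommGroup F] [InnerProductSpace ℝ F]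
    [FiniteDimensional ℝ F] [MeasurableSpace F] [BorelSpace F] :
    (stdGaussian F).map (fun x => -x) = stdGaussian F :=
  stdGaussian_map (LinearIsometryEquiv.neg ℝ)

theorem smul_lmarginal_le {ι : Type*} [DecidableEq ι] {X : ι → Type*}
    [∀ i, MeasurableSpace (X i)] {μ ν : ∀ i, Measure (X i)} [∀ i, SigmaFinite (μ i)]
    [∀ i, SigmaFinite (ν i)] {c : ENNReal} (h : ∀ i, c • μ i ≤ ν i)
    {f : (∀ i, X i) → ENNReal} (hf : Measurable f) (s : Finset ι) (x : ∀ i, X i) :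
    c ^ s.card * (∫⋯∫⁻_s, f ∂μ) x ≤ (∫⋯∫⁻_s, f ∂ν) x := by
  induction s using Finset.induction_on generalizing x with
  | empty => simp
  | insert i s hi ih =>
    rw [lmarginal_insert _ hf hi, lmarginal_insert _ hf hi, Finset.card_insert_of_notMem hi,
      pow_succ]
    have hm : Measurable fun y => (∫⋯∫⁻_s, f ∂μ) (Function.update x i y) :=
      (hf.lmarginal μ).comp (measurable_update x)
    calc c ^ s.card * c * ∫⁻ y, (∫⋯∫⁻_s, f ∂μ) (Function.update x i y) ∂μ i
        = ∫⁻ y, c ^ s.card * (∫⋯∫⁻_s, f ∂μ) (Function.update x i y) ∂(c • μ i) := by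
          rw [lintegral_smul_measure, lintegral_const_mul _ hm, smul_eq_mul]; ring
      _ ≤ ∫⁻ y, (∫⋯∫⁻_s, f ∂ν) (Function.update x i y) ∂ν i :=
          lintegral_mono' (h i) fun y => ih _

/-- Coordinates are integrated out one at a time, each costing a factor `c`. -/
theorem smul_pi_le {ι : Type*} [Fintype ι] [DecidableEq ι] {X : ι → Type*}
    [∀ i, MeasurableSpace (X i)] {μ ν : ∀ i, Measure (X i)} [∀ i, SigmaFinite (μ i)]
    [∀ i, SigmaFinite (ν i)] {c : ENNReal} (h : ∀ i, c • μ i ≤ ν i) :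
    c ^ Fintype.card ι • Measure.pi μ ≤ Measure.pi ν := by
  refine Measure.le_iff.2 fun A hA => ?_
  rcases isEmpty_or_nonempty (∀ i, X i) with hX | ⟨⟨x⟩⟩
  · simp [Set.eq_empty_of_isEmpty A]
  · have := smul_lmarginal_le h (measurable_one.indicator hA) Finset.univ x
    simpa [lmarginal_univ, lintegral_indicator_one hA] using this

theorem exists_smul_restrict_le_gaussianReal (R : ℝ) :
    ∃ c : ENNReal, 0 < c ∧ c ≤ 1 ∧
      c • (volume.restrict (Set.Icc (-R) R)) ≤ gaussianReal 0 1 := by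
  -- On `[-R, R]` the density is smallest at the endpoints; the cap at `1` keeps the constant
  -- finite.
  refine ⟨min 1 (gaussianPDF 0 1 R), lt_min one_pos (gaussianPDF_pos 0 one_ne_zero R),
    min_le_left _ _, Measure.le_iff.2 fun A hA => ?_⟩
  rw [gaussianReal_apply _ one_ne_zero, Measure.smul_apply, smul_eq_mul,
    Measure.restrict_apply hA, ← setLIntegral_const]
  refine le_trans ?_ (lintegral_mono_set (Set.inter_subset_left (t := Set.Icc (-R) R)))
  refine setLIntegral_mono_ae (measurable_gaussianPDF 0 1).aemeasurable (ae_of_all _ ?_)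
  rintro y ⟨-, hy⟩
  refine (min_le_right _ _).trans (ENNReal.ofReal_le_ofReal ?_)
  simp only [gaussianPDFReal]
  have : y ^ 2 ≤ R ^ 2 := sq_le_sq' hy.1 hy.2
  refine mul_le_mul_of_nonneg_left (Real.exp_le_exp.2 ?_) (by positivity)
  refine div_le_div_of_nonneg_right ?_ (by positivity)
  simpa using this

theorem exists_smul_restrict_le_stdGaussian (d : ℕ) (R : ℝ) :
    ∃ c : ENNReal, 0 < c ∧ c ≤ 1 ∧
      c • (volume.restrict (Metric.closedBall (0 : Point d) R)) ≤ stdGaussian (Point d) := by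
  obtain ⟨c, hc0, hc1, hc⟩ := exists_smul_restrict_le_gaussianReal R
  refine ⟨c ^ d, (pow_ne_zero d hc0.ne').bot_lt, pow_le_one₀ zero_le hc1,
    Measure.le_iff.2 fun A hA => ?_⟩
  have h := smul_pi_le (ι := Fin d) (μ := fun _ => volume.restrict (Set.Icc (-R) R))
    (ν := fun _ => gaussianReal 0 1) (fun _ => hc)
  have hm : Measurable (WithLp.toLp 2 : (Fin d → ℝ) → Point d) := by fun_prop
  rw [← map_pi_eq_stdGaussian, Measure.map_apply hm hA]
  refine le_trans ?_ (h _)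
  rw [Fintype.card_fin, ← Measure.restrict_pi_pi, ← volume_pi, Measure.smul_apply,
    Measure.smul_apply, Measure.restrict_apply hA, Measure.restrict_apply (hm hA),
    ← (PiLp.volume_preserving_toLp (Fin d)).measure_preimage
      (hA.inter measurableSet_closedBall).nullMeasurableSet]
  gcongr
  rintro x ⟨hx1, hx2⟩
  refine ⟨hx1, fun i _ => ?_⟩
  have h1 := PiLp.norm_apply_le (WithLp.toLp 2 x : Point d) i
  rw [mem_closedBall_zero_iff] at hx2
  exact abs_le.1 (h1.trans hx2)

theorem sqrt_smul_eq {d : ℕ} {V : Matrix (Fin d) (Fin d) ℝ} (hV : V.PosSemidef) {τ : ℝ}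
    (hτ : 0 ≤ τ) : CFC.sqrt (τ • V) = Real.sqrt τ • CFC.sqrt V := by
  refine CFC.sqrt_unique ?_ ?_
  · rw [smul_mul_smul_comm, Real.mul_self_sqrt hτ, CFC.sqrt_mul_sqrt_self _ hV.nonneg]
  · exact smul_nonneg (Real.sqrt_nonneg _) (CFC.sqrt_nonneg V)

/-- The law is the image of the standard Gaussian under `z ↦ x + √τ L z`. For `x ∈ E` the preimage
of `E` stays in one fixed ball, whose radius is controlled by `τmin`, and the Jacobian factor is
controlled by `τmax`; the constant is thus uniform in `x` and `τ`. -/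
theorem exists_smul_restrict_le_multivariateGaussian {d : ℕ} {E : Set (Point d)}
    (hE_bdd : Bornology.IsBounded E) {V : Matrix (Fin d) (Fin d) ℝ}
    (hV : V.PosDef) {τmin τmax : ℝ} (hτmin : 0 < τmin)
    (hτmax : τmin ≤ τmax) :
    ∃ c : ENNReal, 0 < c ∧ c ≤ 1 ∧ ∀ τ, τmin ≤ τ → τ ≤ τmax → ∀ x ∈ E,
      c • volume.restrict E ≤ multivariateGaussian x (τ • V) := by
  set L : Point d →L[ℝ] Point d := Matrix.toEuclideanCLM (𝕜 := ℝ) (CFC.sqrt V) with hL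
  have hunit : IsUnit L := by
    refine IsUnit.map _ ((CFC.isUnit_sqrt_iff V hV.posSemidef.nonneg).2 hV.isUnit)
  obtain ⟨L', hL'⟩ := hunit
  obtain ⟨D, hD⟩ := hE_bdd.subset_closedBall 0
  set B : Point d →L[ℝ] Point d := ↑L'⁻¹ with hB
  have hBL : ∀ z, B (L z) = z := by
    intro z
    have : B * L = 1 := by rw [hB, ← hL']; exact L'.inv_mul
    exact congrArg (fun T : Point d →L[ℝ] Point d => T z) this
  obtain ⟨c, hc0, hc1, hc⟩ := exists_smul_restrict_le_stdGaussian d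
    (‖B‖ * (D + D) / Real.sqrt τmin)
  have hdet : LinearMap.det (L : Point d →ₗ[ℝ] Point d) ≠ 0 := by
    have hinj : Function.Injective (L : Point d →ₗ[ℝ] Point d) := fun a b hab => by
      rw [← hBL a, ← hBL b]
      exact congrArg B hab
    exact (LinearMap.isUnit_iff_isUnit_det _).1
      ((Module.End.isUnit_iff _).2 ⟨hinj, LinearMap.injective_iff_surjective.1 hinj⟩) |>.ne_zero
  set Δ := LinearMap.det (L : Point d →ₗ[ℝ] Point d) with hΔ
  refine ⟨c * min 1 (ENNReal.ofReal (Real.sqrt τmax ^ d * |Δ|)⁻¹), ?_, ?_, ?_⟩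
  · have h1 : 0 < Real.sqrt τmax := Real.sqrt_pos.2 (hτmin.trans_le hτmax)
    have h2 := abs_pos.2 hdet
    have h3 : 0 < ENNReal.ofReal (Real.sqrt τmax ^ d * |Δ|)⁻¹ := by
      rw [ENNReal.ofReal_pos]; positivity
    exact ENNReal.mul_pos hc0.ne' (lt_min one_pos h3).ne'
  · exact mul_le_one' hc1 (min_le_left _ _)
  intro τ h1 h2 x hx
  have hτ : 0 < τ := hτmin.trans_le h1
  have hsτ : 0 < Real.sqrt τ := Real.sqrt_pos.2 hτ
  have hT : LinearMap.det ((Real.sqrt τ • L : Point d →L[ℝ] Point d) : Point d →ₗ[ℝ] Point d)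
      = Real.sqrt τ ^ d * Δ := by
    rw [ContinuousLinearMap.toLinearMap_smul, LinearMap.det_smul, finrank_euclideanSpace_fin]
  have hT0 : LinearMap.det ((Real.sqrt τ • L : Point d →L[ℝ] Point d) : Point d →ₗ[ℝ] Point d)
      ≠ 0 := by
    rw [hT]; exact mul_ne_zero (pow_pos hsτ d).ne' hdet
  refine Measure.le_iff.2 fun A hA => ?_
  have hm : Measurable fun z : Point d => x + (Real.sqrt τ • L) z := by fun_prop
  have hG : multivariateGaussian x (τ • V) =
      (stdGaussian (Point d)).map fun z => x + (Real.sqrt τ • L) z := by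
    rw [multivariateGaussian, sqrt_smul_eq hV.posSemidef hτ.le, map_smul]
  rw [hG, Measure.map_apply hm hA]
  refine le_trans ?_ (hc _)
  rw [Measure.smul_apply, Measure.smul_apply, Measure.restrict_apply hA,
    Measure.restrict_apply (hm hA), smul_eq_mul, smul_eq_mul, mul_assoc]
  refine mul_le_mul_right ?_ c
  have hvol : volume ((fun z : Point d => x + (Real.sqrt τ • L) z) ⁻¹' (A ∩ E)) =
      ENNReal.ofReal |(Real.sqrt τ ^ d * Δ)⁻¹| * volume (A ∩ E) := by
    rw [show (fun z : Point d => x + (Real.sqrt τ • L) z) ⁻¹' (A ∩ E) =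
      (Real.sqrt τ • L) ⁻¹' ((fun z => x + z) ⁻¹' (A ∩ E)) from rfl,
      Measure.addHaar_preimage_continuousLinearMap _ hT0, hT, measure_preimage_add]
  calc min 1 (ENNReal.ofReal (Real.sqrt τmax ^ d * |Δ|)⁻¹) * volume (A ∩ E)
      ≤ ENNReal.ofReal |(Real.sqrt τ ^ d * Δ)⁻¹| * volume (A ∩ E) := by
        refine mul_le_mul_left ((min_le_right _ _).trans (ENNReal.ofReal_le_ofReal ?_)) _
        rw [abs_inv, abs_mul, abs_of_pos (pow_pos hsτ d)]
        have := abs_pos.2 hdet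
        gcongr
    _ ≤ _ := by
        rw [← hvol]
        refine measure_mono fun z hz => ⟨hz.1, ?_⟩
        rw [mem_closedBall_zero_iff]
        have hy := hD hz.2
        have hx' := hD hx
        rw [mem_closedBall_zero_iff] at hy hx'
        have h3 : ‖(Real.sqrt τ • L) z‖ ≤ D + D := by
          have : (Real.sqrt τ • L) z = (x + (Real.sqrt τ • L) z) - x := by abel
          rw [this]
          exact (norm_sub_le _ _).trans (add_le_add hy hx')
        have h4 : Real.sqrt τ * ‖z‖ ≤ ‖B‖ * (D + D) := by
          have : Real.sqrt τ • z = B ((Real.sqrt τ • L) z) := by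
            rw [smul_apply, map_smul, hBL]
          rw [← abs_of_pos hsτ, ← Real.norm_eq_abs, ← norm_smul, this]
          exact (B.le_opNorm _).trans (by gcongr)
        rw [le_div_iff₀ (Real.sqrt_pos.2 hτmin), mul_comm]
        refine le_trans ?_ h4
        gcongr

end Gaussian

/-! ### Selection probabilities, reversibility of the proposal, detailed balance. -/

section Kernels

open scoped MatrixOrder

variable {d N : ℕ}

/-- The probability that the point of index `k` is the one to be moved. -/
noncomputable def moveProb (γ : ℝ) (k : Fin N) (X : Design d N) : ℝ :=
  ∑ j ∈ Finset.univ.filter (fun j => j ≠ k), 1 / 2 * (pairWeight γ X k j / totalWeight γ X)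

theorem proposalDensity_eq (γ : ℝ) (V : Matrix (Fin d) (Fin d) ℝ) (τ : ℝ) (k : Fin N)
    (X Y : Design d N) :
    proposalDensity γ V τ k X Y = gaussianDensity (X k) (τ • V) (Y k) * moveProb γ k X := rfl

theorem measurable_moveProb (γ : ℝ) (k : Fin N) :
    Measurable (moveProb γ k : Design d N → ℝ) :=
  Finset.measurable_sum _ fun j _ =>
    ((measurable_pairWeight γ k j).div (measurable_totalWeight γ)).const_mul _

theorem moveProb_nonneg {γ : ℝ} (hγ : 0 < γ) (k : Fin N) (X : Design d N) :
    0 ≤ moveProb γ k X :=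
  Finset.sum_nonneg fun j _ => mul_nonneg (by norm_num)
    (div_nonneg (pairWeight_pos hγ X _ _).le (totalWeight_nonneg hγ X))

theorem pairWeight_comm (γ : ℝ) (X : Design d N) (i j : Fin N) :
    pairWeight γ X i j = pairWeight γ X j i := by
  rw [pairWeight, pairWeight, norm_sub_rev]

theorem moveProb_pos (hN : 2 ≤ N) {γ : ℝ} (hγ : 0 < γ) (k : Fin N) (X : Design d N) :
    0 < moveProb γ k X := by
  have : Nontrivial (Fin N) := Fin.nontrivial_iff_two_le.2 hN
  obtain ⟨j, hj⟩ := exists_ne k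
  exact Finset.sum_pos (fun j _ => mul_pos (by norm_num)
    (div_pos (pairWeight_pos hγ X _ _) (totalWeight_pos hN hγ X))) ⟨j, by simpa using hj⟩

/-- Distances in `E` are at most `2D`, so a single pair weighs at least `1/(2D + γ)`, while the
total is at most `1/γ` per pair; one term of the sum suffices. -/
theorem exists_le_moveProb (hN : 2 ≤ N) {γ : ℝ} (hγ : 0 < γ) {E : Set (Point d)}
    (hE : Bornology.IsBounded E) :
    ∃ w : ℝ, 0 < w ∧ w ≤ 1 ∧ ∀ k : Fin N, ∀ X ∈ designsIn N E, w ≤ moveProb γ k X := by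
  obtain ⟨D, hD0, hD⟩ := hE.subset_closedBall_lt 0 0
  have : Nonempty (Pair N) := ⟨⟨(⟨0, by omega⟩, ⟨1, by omega⟩), by simp⟩⟩
  have hP : (0 : ℝ) < Fintype.card (Pair N) := by exact_mod_cast Fintype.card_pos
  refine ⟨min 1 (1 / 2 * (1 / (D + D + γ) / (Fintype.card (Pair N) * (1 / γ)))), ?_,
    min_le_left _ _, fun k X hX => ?_⟩
  · refine lt_min one_pos ?_; positivity
  refine (min_le_right _ _).trans ?_
  have : Nontrivial (Fin N) := Fin.nontrivial_iff_two_le.2 hN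
  obtain ⟨j, hj⟩ := exists_ne k
  have htot : totalWeight γ X ≤ Fintype.card (Pair N) * (1 / γ) := by
    calc totalWeight γ X ≤ ∑ _p : Pair N, 1 / γ := Finset.sum_le_sum fun p _ => by
          unfold pairWeight
          gcongr
          exact le_add_of_nonneg_left (norm_nonneg _)
      _ = _ := by simp
  have hw : 1 / (D + D + γ) ≤ pairWeight γ X k j := by
    have h1 := hD (hX k)
    have h2 := hD (hX j)
    rw [mem_closedBall_zero_iff] at h1 h2
    unfold pairWeight
    gcongr
    exact (norm_sub_le _ _).trans (add_le_add h1 h2)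
  have hpos := totalWeight_pos hN hγ X
  calc _ ≤ 1 / 2 * (pairWeight γ X k j / totalWeight γ X) := by
        have := (pairWeight_pos hγ X k j).le
        gcongr
    _ ≤ moveProb γ k X := by
        refine Finset.single_le_sum (f := fun j => 1 / 2 * (pairWeight γ X k j / totalWeight γ X))
          (fun i _ => ?_) (by simpa using hj)
        exact mul_nonneg (by norm_num) (div_nonneg (pairWeight_pos hγ X _ _).le hpos.le)

theorem lintegral_proposal (V : Matrix (Fin d) (Fin d) ℝ) (τ : ℝ) (k : Fin N) (X : Design d N)
    {f : Design d N → ENNReal} (hf : Measurable f) :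
    ∫⁻ Y, f Y ∂(proposal V τ k X) =
      ∫⁻ y, f (Function.update X k y) ∂(multivariateGaussian (X k) (τ • V)) :=
  lintegral_map hf (measurable_update X)

/-- The proposal becomes a translation by noise whose law does not depend on `X`, so that
translation invariance of Lebesgue measure applies. -/
theorem lintegral_proposal_eq_translate (V : Matrix (Fin d) (Fin d) ℝ) (τ : ℝ) (k : Fin N)
    (X : Design d N) {f : Design d N → ENNReal} (hf : Measurable f) :
    ∫⁻ Y, f Y ∂(proposal V τ k X) =
      ∫⁻ z, f (X + Pi.single k (Matrix.toEuclideanCLM (𝕜 := ℝ) (CFC.sqrt (τ • V)) z))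
        ∂(stdGaussian (Point d)) := by
  rw [lintegral_proposal V τ k X hf, multivariateGaussian]
  refine (lintegral_map (hf.comp (measurable_update X)) (by fun_prop)).trans ?_
  refine lintegral_congr fun z => ?_
  refine congrArg f (funext fun i => ?_)
  by_cases h : i = k
  · subst h; simp
  · simp [h]

theorem measurable_single (k : Fin N) :
    Measurable (fun v : Point d => (Pi.single k v : Design d N)) :=
  measurable_update (0 : Design d N)

/-- The proposal is reversible with respect to Lebesgue measure. -/
theorem lintegral_proposal_symm (V : Matrix (Fin d) (Fin d) ℝ) (τ : ℝ) (k : Fin N)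
    {F : Design d N × Design d N → ENNReal} (hF : Measurable F) :
    ∫⁻ X, ∫⁻ Y, F (X, Y) ∂(proposal V τ k X) = ∫⁻ X, ∫⁻ Y, F (Y, X) ∂(proposal V τ k X) := by
  set v : Point d → Design d N := fun z =>
    Pi.single k (Matrix.toEuclideanCLM (𝕜 := ℝ) (CFC.sqrt (τ • V)) z) with hv
  have hvm : Measurable v := (measurable_single k).comp (by fun_prop)
  have hneg : ∀ z, v (-z) = -v z := fun z => by simp [hv, map_neg, Pi.single_neg]
  have hm1 : Measurable fun p : Design d N × Point d => F (p.1, p.1 + v p.2) :=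
    hF.comp (measurable_fst.prodMk (measurable_fst.add (hvm.comp measurable_snd)))
  have hm2 : Measurable fun p : Design d N × Point d => F (p.1 + v p.2, p.1) :=
    hF.comp ((measurable_fst.add (hvm.comp measurable_snd)).prodMk measurable_fst)
  calc ∫⁻ X, ∫⁻ Y, F (X, Y) ∂(proposal V τ k X)
      = ∫⁻ X, ∫⁻ z, F (X, X + v z) ∂(stdGaussian (Point d)) :=
        lintegral_congr fun X =>
          lintegral_proposal_eq_translate V τ k X (hF.comp measurable_prodMk_left)
    _ = ∫⁻ z, ∫⁻ X, F (X, X + v z) ∂volume ∂(stdGaussian (Point d)) :=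
        lintegral_lintegral_swap hm1.aemeasurable
    _ = ∫⁻ z, ∫⁻ X, F (X + v (-z), X) ∂volume ∂(stdGaussian (Point d)) := by
        refine lintegral_congr fun z => ?_
        -- Shifting `X` by `v z` exchanges departure and arrival; the displacement becomes `v (-z)`,
        -- and the symmetry of the Gaussian then removes the sign.
        rw [← lintegral_add_right_eq_self (fun X => F (X + v (-z), X)) (v z)]
        simp [hneg]
    _ = ∫⁻ z, ∫⁻ X, F (X + v z, X) ∂volume ∂(stdGaussian (Point d)) := by
        conv_rhs => rw [← stdGaussian_map_neg]
        rw [lintegral_map _ measurable_neg]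
        exact Measurable.lintegral_prod_left' hm2
    _ = ∫⁻ X, ∫⁻ z, F (X + v z, X) ∂(stdGaussian (Point d)) :=
        (lintegral_lintegral_swap hm2.aemeasurable).symm
    _ = _ := (lintegral_congr fun X =>
          lintegral_proposal_eq_translate V τ k X (hF.comp measurable_prodMk_right)).symm

open Classical in
/-- The probability that the proposal `z.2` is accepted, from the design `z.1`. -/
noncomputable def acceptMass (E : Set (Point d)) (γ : ℝ) (V : Matrix (Fin d) (Fin d) ℝ)
    (β τ : ℝ) (k : Fin N) (z : Design d N × Design d N) : ENNReal :=
  if z.2 ∈ designsIn N E then ENNReal.ofReal (acceptProb E γ V β τ k z.1 z.2) else 0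

open Classical in
/-- The probability that the proposal `z.2` is rejected, from the design `z.1`. -/
noncomputable def rejectMass (E : Set (Point d)) (γ : ℝ) (V : Matrix (Fin d) (Fin d) ℝ)
    (β τ : ℝ) (k : Fin N) (z : Design d N × Design d N) : ENNReal :=
  if z.2 ∈ designsIn N E then ENNReal.ofReal (1 - acceptProb E γ V β τ k z.1 z.2) else 1

theorem measurable_acceptMass {E : Set (Point d)} (hE : MeasurableSet E) (γ : ℝ)
    (V : Matrix (Fin d) (Fin d) ℝ) (β τ : ℝ) (k : Fin N) :
    Measurable (acceptMass E γ V β τ k) :=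
  Measurable.ite (measurable_snd (measurableSet_designsIn hE))
    (measurable_acceptProb E γ V β τ k).ennreal_ofReal measurable_const

theorem measurable_rejectMass {E : Set (Point d)} (hE : MeasurableSet E) (γ : ℝ)
    (V : Matrix (Fin d) (Fin d) ℝ) (β τ : ℝ) (k : Fin N) :
    Measurable (rejectMass E γ V β τ k) :=
  Measurable.ite (measurable_snd (measurableSet_designsIn hE))
    ((measurable_acceptProb E γ V β τ k).const_sub 1).ennreal_ofReal measurable_const

theorem acceptMass_add_rejectMass (E : Set (Point d)) {γ : ℝ} (hγ : 0 < γ)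
    (V : Matrix (Fin d) (Fin d) ℝ) (β τ : ℝ) (k : Fin N) (z : Design d N × Design d N) :
    acceptMass E γ V β τ k z + rejectMass E γ V β τ k z = 1 := by
  unfold acceptMass rejectMass
  split_ifs
  · rw [← ENNReal.ofReal_add (acceptProb_nonneg E hγ V β τ k _ _)
      (sub_nonneg.2 (acceptProb_le_one E γ V β τ k _ _))]
    simp
  · simp

theorem lintegral_acceptReject {E : Set (Point d)} (hE : MeasurableSet E) (γ : ℝ)
    (V : Matrix (Fin d) (Fin d) ℝ) (β τ : ℝ) (k : Fin N) (z : Design d N × Design d N)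
    {f : Design d N → ENNReal} (hf : Measurable f) :
    ∫⁻ Y, f Y ∂(acceptReject hE γ V β τ k z) =
      acceptMass E γ V β τ k z * f z.2 + rejectMass E γ V β τ k z * f z.1 := by
  unfold acceptMass rejectMass
  by_cases h : z.2 ∈ designsIn N E
  · rw [show acceptReject hE γ V β τ k z = _ from if_pos h]
    simp [h, lintegral_add_measure, lintegral_smul_measure, lintegral_dirac' _ hf]
  · rw [show acceptReject hE γ V β τ k z = _ from if_neg h]
    simp [h, lintegral_dirac' _ hf]

theorem lintegral_move {E : Set (Point d)} (hE : MeasurableSet E) (γ : ℝ)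
    (V : Matrix (Fin d) (Fin d) ℝ) (β τ : ℝ) (k : Fin N) (X : Design d N)
    {f : Design d N → ENNReal} (hf : Measurable f) :
    ∫⁻ Y, f Y ∂(move hE γ V β τ k X) =
      ∫⁻ Y, acceptMass E γ V β τ k (X, Y) * f Y ∂(proposal V τ k X) +
      ∫⁻ Y, rejectMass E γ V β τ k (X, Y) * f X ∂(proposal V τ k X) := by
  have hA := measurable_acceptMass (N := N) hE γ V β τ k
  have hm : Measurable fun z => ∫⁻ Y, f Y ∂(acceptReject hE γ V β τ k z) :=
    hf.lintegral_kernel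
  rw [move, Kernel.lintegral_comp _ _ _ hf, Kernel.prod_apply, Kernel.id_apply,
    Measure.dirac_prod, lintegral_map hm measurable_prodMk_left]
  simp only [lintegral_acceptReject hE γ V β τ k _ hf]
  exact lintegral_add_left ((hA.comp measurable_prodMk_left).mul hf) _

/-- Regroups the draws of a pair and of one of its two indices according to the index that is moved.
-/
theorem sum_pairs_eq (q : Fin N → Fin N → ENNReal) (hq : ∀ i j, q i j = q j i)
    (m : Fin N → ENNReal) :
    ∑ p : Pair N, q p.1.1 p.1.2 * (2⁻¹ * m p.1.1 + 2⁻¹ * m p.1.2) =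
      ∑ k, (∑ j ∈ Finset.univ.filter (fun j => j ≠ k), 2⁻¹ * q k j) * m k := by
  have h1 : ∀ F : Fin N → Fin N → ENNReal,
      ∑ p : Pair N, F p.1.1 p.1.2 = ∑ i, ∑ j, if i < j then F i j else 0 := by
    intro F
    rw [← Finset.sum_product', ← Finset.sum_filter, Finset.univ_product_univ]
    exact (Finset.sum_subtype (Finset.univ.filter fun p : Fin N × Fin N => p.1 < p.2)
      (by simp) (fun p => F p.1 p.2)).symm
  rw [h1 fun i j => q i j * (2⁻¹ * m i + 2⁻¹ * m j)]
  have h2 : ∀ i j, (if i < j then q i j * (2⁻¹ * m i + 2⁻¹ * m j) else 0) =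
      (if i < j then 2⁻¹ * q i j * m i else 0) + (if i < j then 2⁻¹ * q j i * m j else 0) := by
    intro i j
    split_ifs
    · rw [hq j i]; ring
    · simp
  simp only [h2, Finset.sum_add_distrib]
  rw [Finset.sum_comm (f := fun i j => if i < j then 2⁻¹ * q j i * m j else 0),
    ← Finset.sum_add_distrib]
  refine Finset.sum_congr rfl fun k _ => ?_
  rw [← Finset.sum_add_distrib, Finset.sum_mul, Finset.sum_filter]
  refine Finset.sum_congr rfl fun j _ => ?_
  rcases lt_trichotomy k j with h | h | h
  · simp [h, h.not_gt, h.ne']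
  · simp [h]
  · simp [h, h.not_gt, h.ne]

theorem lintegral_stepKernel (hN : 2 ≤ N) {E : Set (Point d)} (hE : MeasurableSet E) {γ : ℝ}
    (hγ : 0 < γ) (V : Matrix (Fin d) (Fin d) ℝ) (β τ : ℝ) (X : Design d N)
    (f : Design d N → ENNReal) :
    ∫⁻ Y, f Y ∂(stepKernel hN hE hγ V β τ X) =
      ∑ k, ENNReal.ofReal (moveProb γ k X) * ∫⁻ Y, f Y ∂(move hE γ V β τ k X) := by
  have h0 : stepKernel hN hE hγ V β τ X = ∑ p : Pair N, pairLaw hN hγ X p •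
    ((2⁻¹ : ENNReal) • move hE γ V β τ p.1.1 X + (2⁻¹ : ENNReal) • move hE γ V β τ p.1.2 X) := rfl
  rw [h0, lintegral_finsetSum_measure]
  simp only [lintegral_smul_measure, lintegral_add_measure, smul_eq_mul, pairLaw,
    PMF.ofFintype_apply]
  rw [sum_pairs_eq (fun i j => ENNReal.ofReal (pairWeight γ X i j / totalWeight γ X))
    (fun i j => by rw [pairWeight_comm]) (fun k => ∫⁻ Y, f Y ∂(move hE γ V β τ k X))]
  refine Finset.sum_congr rfl fun k _ => ?_
  congr 1
  rw [moveProb, ENNReal.ofReal_sum_of_nonneg fun j _ => mul_nonneg (by norm_num)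
    (div_nonneg (pairWeight_pos hγ X _ _).le (totalWeight_nonneg hγ X))]
  refine Finset.sum_congr rfl fun j _ => ?_
  rw [ENNReal.ofReal_mul (by norm_num), one_div, ENNReal.ofReal_inv_of_pos two_pos]
  simp

theorem sum_moveProb (hN : 2 ≤ N) {γ : ℝ} (hγ : 0 < γ) (X : Design d N) :
    ∑ k, ENNReal.ofReal (moveProb γ k X) = 1 := by
  -- The normalization is read off from the total mass of a step kernel, so any values of `E`, `V`,
  -- `β` and `τ` will do.
  have := fun k : Fin N => isMarkovKernel_move (d := d) (N := N) MeasurableSet.univ hγ 1 0 0 k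
  have h := lintegral_stepKernel (d := d) hN MeasurableSet.univ hγ 1 0 0 X (fun _ => 1)
  simpa using h.symm

theorem gaussianDensity_comm (μ : Point d) (S : Matrix (Fin d) (Fin d) ℝ) (y : Point d) :
    gaussianDensity μ S y = gaussianDensity y S μ := by
  unfold gaussianDensity
  have : (fun i => y i - μ i) = -(fun i => μ i - y i) := by ext i; simp
  rw [this, Matrix.mulVec_neg, neg_dotProduct_neg]

theorem gaussianDensity_pos (μ : Point d) {S : Matrix (Fin d) (Fin d) ℝ} (hS : S.PosDef)
    (y : Point d) : 0 < gaussianDensity μ S y := by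
  have := hS.det_pos
  unfold gaussianDensity
  positivity

/-- The Gaussian density is symmetric in its mean and its argument, so it cancels from the ratio. -/
theorem acceptProb_eq {γ : ℝ} {V : Matrix (Fin d) (Fin d) ℝ} (hV : V.PosDef)
    (E : Set (Point d)) (β : ℝ) {τ : ℝ} (hτ : 0 < τ) (k : Fin N) (X Y : Design d N) :
    acceptProb E γ V β τ k X Y = min 1 (Real.exp (-β * (energy E Y - energy E X)) *
      (moveProb γ k Y / moveProb γ k X)) := by
  rw [acceptProb, proposalDensity_eq, proposalDensity_eq, gaussianDensity_comm (Y k),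
    mul_div_mul_left _ _ (gaussianDensity_pos _ (hV.smul hτ) _).ne']

/-- The right-hand side is symmetric in `X` and `Y`, which is the detailed balance condition. -/
theorem acceptProb_balance (hN : 2 ≤ N) {γ : ℝ} (hγ : 0 < γ) {V : Matrix (Fin d) (Fin d) ℝ}
    (hV : V.PosDef) (E : Set (Point d)) (β : ℝ) {τ : ℝ} (hτ : 0 < τ) (k : Fin N)
    (X Y : Design d N) :
    Real.exp (-β * energy E X) * moveProb γ k X * acceptProb E γ V β τ k X Y =
      min (Real.exp (-β * energy E X) * moveProb γ k X)
        (Real.exp (-β * energy E Y) * moveProb γ k Y) := by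
  have h1 := moveProb_pos hN hγ k X
  have h2 := Real.exp_pos (-β * energy E X)
  rw [acceptProb_eq hV E β hτ, mul_min_of_nonneg _ _ (by positivity), mul_one]
  congr 1
  rw [mul_sub, Real.exp_sub]
  field_simp

end Kernels

/-! ### Invariance of the Gibbs measure and of `E^N`. -/

section Invariance

variable {d N : ℕ}

open Classical in
/-- The unnormalized Gibbs density `e^{-βU}` on `E^N`, extended by `0`. -/
noncomputable def gibbsWeight (E : Set (Point d)) (β : ℝ) (X : Design d N) : ENNReal :=
  if X ∈ designsIn N E then ENNReal.ofReal (Real.exp (-β * energy E X)) else 0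

theorem measurable_gibbsWeight {E : Set (Point d)} (hE : MeasurableSet E) (β : ℝ) :
    Measurable (gibbsWeight E β : Design d N → ENNReal) :=
  Measurable.ite (measurableSet_designsIn hE)
    ((measurable_energy E).const_mul (-β)).exp.ennreal_ofReal measurable_const

theorem gibbsWeight_balance (hN : 2 ≤ N) {γ : ℝ} (hγ : 0 < γ) {V : Matrix (Fin d) (Fin d) ℝ}
    (hV : V.PosDef) (E : Set (Point d)) (β : ℝ) {τ : ℝ} (hτ : 0 < τ) (k : Fin N)
    (X Y : Design d N) :
    gibbsWeight E β X * ENNReal.ofReal (moveProb γ k X) * acceptMass E γ V β τ k (X, Y) =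
      gibbsWeight E β Y * ENNReal.ofReal (moveProb γ k Y) * acceptMass E γ V β τ k (Y, X) := by
  unfold gibbsWeight acceptMass
  by_cases hX : X ∈ designsIn N E <;> by_cases hY : Y ∈ designsIn N E <;> simp only [hX, hY,
    if_true, if_false, zero_mul, mul_zero]
  have h1 := fun X => (moveProb_pos (d := d) hN hγ k X).le
  have h2 := fun X : Design d N => (Real.exp_pos (-β * energy E X)).le
  rw [← ENNReal.ofReal_mul (h2 _), ← ENNReal.ofReal_mul (h2 _),
    ← ENNReal.ofReal_mul (mul_nonneg (h2 _) (h1 _)),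
    ← ENNReal.ofReal_mul (mul_nonneg (h2 _) (h1 _)),
    acceptProb_balance hN hγ hV E β hτ, acceptProb_balance hN hγ hV E β hτ, min_comm]

/-- The selection of the index depends on the state, so a single move preserves the Gibbs weight
times `moveProb γ k`, not the Gibbs weight itself. Detailed balance and the symmetry of the proposal
replace `f Y` by `f X` in the accepted part; acceptance and rejection then add up to `1`. -/
theorem lintegral_gibbsWeight_move (hN : 2 ≤ N) {E : Set (Point d)} (hE : MeasurableSet E)
    {γ : ℝ} (hγ : 0 < γ) {V : Matrix (Fin d) (Fin d) ℝ} (hV : V.PosDef) (β : ℝ) {τ : ℝ}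
    (hτ : 0 < τ) (k : Fin N) {f : Design d N → ENNReal} (hf : Measurable f) :
    ∫⁻ X, gibbsWeight E β X * ENNReal.ofReal (moveProb γ k X) *
        ∫⁻ Y, f Y ∂(move hE γ V β τ k X) =
      ∫⁻ X, gibbsWeight E β X * ENNReal.ofReal (moveProb γ k X) * f X := by
  set g : Design d N → ENNReal := fun X => gibbsWeight E β X * ENNReal.ofReal (moveProb γ k X)
    with hg
  have hgm : Measurable g :=
    (measurable_gibbsWeight hE β).mul (measurable_moveProb γ k).ennreal_ofReal
  have hA := measurable_acceptMass (N := N) hE γ V β τ k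
  have hR := measurable_rejectMass (N := N) hE γ V β τ k
  have hbal : ∀ X Y, g X * acceptMass E γ V β τ k (X, Y) = g Y * acceptMass E γ V β τ k (Y, X) :=
    gibbsWeight_balance hN hγ hV E β hτ k
  have hF : Measurable fun z : Design d N × Design d N =>
      g z.1 * acceptMass E γ V β τ k z * f z.2 :=
    ((hgm.comp measurable_fst).mul hA).mul (hf.comp measurable_snd)
  have hF' : Measurable fun z : Design d N × Design d N =>
      g z.1 * acceptMass E γ V β τ k z * f z.1 :=
    ((hgm.comp measurable_fst).mul hA).mul (hf.comp measurable_fst)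
  have hswap : ∫⁻ X, ∫⁻ Y, g X * acceptMass E γ V β τ k (X, Y) * f Y ∂(proposal V τ k X) =
      ∫⁻ X, ∫⁻ Y, g X * acceptMass E γ V β τ k (X, Y) * f X ∂(proposal V τ k X) := by
    rw [lintegral_proposal_symm V τ k hF]
    simp only [hbal]
  calc ∫⁻ X, g X * ∫⁻ Y, f Y ∂(move hE γ V β τ k X)
      = ∫⁻ X, (∫⁻ Y, g X * acceptMass E γ V β τ k (X, Y) * f Y ∂(proposal V τ k X) +
          ∫⁻ Y, g X * (rejectMass E γ V β τ k (X, Y) * f X) ∂(proposal V τ k X)) := by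
        refine lintegral_congr fun X => ?_
        simp only [mul_assoc]
        rw [lintegral_move hE γ V β τ k X hf, mul_add, lintegral_const_mul, lintegral_const_mul]
        · exact (hR.comp measurable_prodMk_left).mul measurable_const
        · exact (hA.comp measurable_prodMk_left).mul hf
    _ = (∫⁻ X, ∫⁻ Y, g X * acceptMass E γ V β τ k (X, Y) * f X ∂(proposal V τ k X)) +
          ∫⁻ X, ∫⁻ Y, g X * (rejectMass E γ V β τ k (X, Y) * f X) ∂(proposal V τ k X) := by
        rw [lintegral_add_left hF.lintegral_kernel_prod_right', hswap]
    _ = ∫⁻ X, ∫⁻ _, g X * f X ∂(proposal V τ k X) := by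
        rw [← lintegral_add_left hF'.lintegral_kernel_prod_right']
        refine lintegral_congr fun X => ?_
        refine (lintegral_add_left (hF'.comp measurable_prodMk_left) _).symm.trans ?_
        refine lintegral_congr fun Y => ?_
        have := acceptMass_add_rejectMass E hγ V β τ k (X, Y)
        simp only [Function.comp_apply]
        calc _ = g X * (acceptMass E γ V β τ k (X, Y) + rejectMass E γ V β τ k (X, Y)) * f X := by
              ring
          _ = _ := by rw [this, mul_one]
    _ = ∫⁻ X, g X * f X := by simp

/-- The unnormalized Gibbs measure on `E^N`. -/
noncomputable def gibbsMeasure (N : ℕ) (E : Set (Point d)) (β : ℝ) : Measure (Design d N) :=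
  volume.withDensity (gibbsWeight E β)

/-- Summing over `k` the measures preserved by each move recovers the Gibbs measure, because the
selection probabilities add up to `1`. -/
theorem gibbsMeasure_bind_stepKernel (hN : 2 ≤ N) {E : Set (Point d)} (hE : MeasurableSet E)
    {γ : ℝ} (hγ : 0 < γ) {V : Matrix (Fin d) (Fin d) ℝ} (hV : V.PosDef) (β : ℝ) {τ : ℝ}
    (hτ : 0 < τ) :
    (gibbsMeasure N E β).bind (stepKernel hN hE hγ V β τ) = gibbsMeasure N E β := by
  have hGm := measurable_gibbsWeight (N := N) hE β
  refine Measure.ext_of_lintegral _ fun f hf => ?_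
  rw [Measure.lintegral_bind (Kernel.aemeasurable _) hf.aemeasurable, gibbsMeasure,
    lintegral_withDensity_eq_lintegral_mul _ hGm hf.lintegral_kernel,
    lintegral_withDensity_eq_lintegral_mul _ hGm hf]
  simp only [Pi.mul_apply, lintegral_stepKernel hN hE hγ, Finset.mul_sum, ← mul_assoc]
  have hw := fun k => (measurable_moveProb (d := d) (N := N) γ k).ennreal_ofReal
  rw [lintegral_finsetSum]
  · simp only [lintegral_gibbsWeight_move hN hE hγ hV β hτ _ hf]
    rw [← lintegral_finsetSum]
    · refine lintegral_congr fun X => ?_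
      rw [← Finset.sum_mul, ← Finset.mul_sum, sum_moveProb hN hγ, mul_one]
    · exact fun k _ => (hGm.mul (hw k)).mul hf
  · intro k _
    have := isMarkovKernel_move hE hγ V β τ k
    exact (hGm.mul (hw k)).mul hf.lintegral_kernel

theorem move_designsIn {E : Set (Point d)} (hE : MeasurableSet E) (γ : ℝ)
    (V : Matrix (Fin d) (Fin d) ℝ) (β τ : ℝ) (k : Fin N) {X : Design d N}
    (hX : X ∈ designsIn N E) : move hE γ V β τ k X (designsIn N E)ᶜ = 0 := by
  have hS := measurableSet_designsIn (N := N) hE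
  rw [← lintegral_indicator_one hS.compl,
    lintegral_move hE γ V β τ k X (measurable_one.indicator hS.compl)]
  have h1 : ∀ Y, acceptMass E γ V β τ k (X, Y) * (designsIn N E)ᶜ.indicator 1 Y = 0 := by
    intro Y
    by_cases hY : Y ∈ designsIn N E <;> simp [acceptMass, hY]
  simp [h1, hX]

theorem stepKernel_designsIn (hN : 2 ≤ N) {E : Set (Point d)} (hE : MeasurableSet E) {γ : ℝ}
    (hγ : 0 < γ) (V : Matrix (Fin d) (Fin d) ℝ) (β τ : ℝ) {X : Design d N}
    (hX : X ∈ designsIn N E) : stepKernel hN hE hγ V β τ X (designsIn N E)ᶜ = 0 := by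
  have hS := measurableSet_designsIn (N := N) hE
  rw [← lintegral_indicator_one hS.compl, lintegral_stepKernel]
  simp [lintegral_indicator_one hS.compl, move_designsIn hE γ V β τ _ hX]

end Invariance

/-! ### Lower bound for one iteration. -/

section Minorization

variable {d N : ℕ}

theorem separation_nonneg (X : Design d N) : 0 ≤ separation X :=
  Real.iInf_nonneg fun _ => norm_nonneg _

theorem separation_le (hN : 2 ≤ N) {E : Set (Point d)} (hE : Bornology.IsBounded E)
    {X : Design d N} (hX : X ∈ designsIn N E) : separation X ≤ Metric.diam E := by
  let p : {p : Fin N × Fin N // p.1 ≠ p.2} := ⟨(⟨0, by omega⟩, ⟨1, by omega⟩), by simp⟩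
  refine (ciInf_le ⟨0, ?_⟩ p).trans ?_
  · rintro _ ⟨q, rfl⟩; exact norm_nonneg _
  · rw [← dist_eq_norm]
    exact Metric.dist_le_diam_of_mem hE (hX _) (hX _)

/-- The diameter of `E` is an admissible bound, so the infimum runs over a nonempty set and inherits
the defining inequalities. -/
theorem osc_spec (hN : 2 ≤ N) {E : Set (Point d)} (hE : Bornology.IsBounded E) :
    0 ≤ osc N E ∧ ∀ X ∈ designsIn N E, ∀ Y ∈ designsIn N E,
      energy E Y - energy E X ≤ osc N E := by
  have hne : {h : ℝ | 0 ≤ h ∧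
      ∀ X ∈ designsIn N E, ∀ Y ∈ designsIn N E, energy E Y - energy E X ≤ h}.Nonempty := by
    refine ⟨Metric.diam E, Metric.diam_nonneg, fun X hX Y hY => ?_⟩
    have h1 := separation_nonneg Y
    have h2 := separation_le hN hE hX
    unfold energy
    linarith
  exact ⟨le_csInf hne fun h hh => hh.1, fun X hX Y hY => le_csInf hne fun h hh => hh.2 X hX Y hY⟩

theorem update_mem_designsIn {E : Set (Point d)} {X : Design d N} (hX : X ∈ designsIn N E)
    (k : Fin N) {y : Point d} (hy : y ∈ E) : Function.update X k y ∈ designsIn N E := by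
  intro i
  by_cases h : i = k
  · subst h; simpa using hy
  · simpa [h] using hX i

/-- Multiplying by `moveProb γ k X` clears the ratio of selection probabilities: the minimum is then
between `moveProb γ k X` and `moveProb γ k Y` times an exponential that is at least `e^{-β osc(U)}`.
-/
theorem le_moveProb_mul_acceptMass (hN : 2 ≤ N) {E : Set (Point d)}
    (hE_bdd : Bornology.IsBounded E) {γ : ℝ} (hγ : 0 < γ) {V : Matrix (Fin d) (Fin d) ℝ}
    (hV : V.PosDef) {β : ℝ} (hβ : 0 ≤ β) {τ : ℝ} (hτ : 0 < τ) {w : ℝ} (hw0 : 0 < w)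
    (hw : ∀ k : Fin N, ∀ X ∈ designsIn N E, w ≤ moveProb γ k X) (k : Fin N) {X Y : Design d N}
    (hX : X ∈ designsIn N E) (hY : Y ∈ designsIn N E) :
    ENNReal.ofReal (w * Real.exp (-β * osc N E)) ≤
      ENNReal.ofReal (moveProb γ k X) * acceptMass E γ V β τ k (X, Y) := by
  have hp := moveProb_pos hN hγ k X
  obtain ⟨ho, hosc⟩ := osc_spec hN hE_bdd
  rw [acceptMass, if_pos hY, ← ENNReal.ofReal_mul hp.le]
  refine ENNReal.ofReal_le_ofReal ?_
  rw [acceptProb_eq hV E β hτ, mul_min_of_nonneg _ _ hp.le, mul_one]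
  refine le_min ?_ ?_
  · calc w * Real.exp (-β * osc N E) ≤ w * 1 := by
          gcongr
          exact Real.exp_le_one_iff.2 (by nlinarith)
      _ ≤ _ := by rw [mul_one]; exact hw k X hX
  · calc w * Real.exp (-β * osc N E)
        ≤ moveProb γ k Y * Real.exp (-β * (energy E Y - energy E X)) := by
          refine mul_le_mul (hw k Y hY) (Real.exp_le_exp.2 ?_) (Real.exp_pos _).le
            (moveProb_nonneg hγ k Y)
          have := mul_le_mul_of_nonneg_left (hosc X hX Y hY) hβ
          linarith
      _ = _ := by field_simp

/-- Discarding rejections and moves of other indices leaves at least a multiple of Lebesgue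
resampling of `x_k` in `E`. -/
theorem le_lintegral_stepKernel (hN : 2 ≤ N) {E : Set (Point d)}
    (hE_bdd : Bornology.IsBounded E) (hE : MeasurableSet E) {γ : ℝ} (hγ : 0 < γ)
    {V : Matrix (Fin d) (Fin d) ℝ} (hV : V.PosDef) {β : ℝ} (hβ : 0 ≤ β) {τ : ℝ} (hτ : 0 < τ)
    {w : ℝ} (hw0 : 0 < w) (hw : ∀ k : Fin N, ∀ X ∈ designsIn N E, w ≤ moveProb γ k X)
    {c : ENNReal}
    (hc : ∀ x ∈ E, c • volume.restrict E ≤ multivariateGaussian x (τ • V))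
    (k : Fin N) {X : Design d N} (hX : X ∈ designsIn N E)
    {f : Design d N → ENNReal} (hf : Measurable f) :
    ENNReal.ofReal (w * Real.exp (-β * osc N E)) * c *
        ∫⁻ y in E, f (Function.update X k y) ≤
      ∫⁻ Y, f Y ∂(stepKernel hN hE hγ V β τ X) := by
  have hA := measurable_acceptMass (N := N) hE γ V β τ k
  have hAf : Measurable fun Y => acceptMass E γ V β τ k (X, Y) * f Y :=
    (hA.comp measurable_prodMk_left).mul hf
  have hu := measurable_update X (a := k)
  have hfu : Measurable fun y => f (Function.update X k y) := hf.comp hu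
  have hAfu : Measurable fun y => acceptMass E γ V β τ k (X, Function.update X k y) *
      f (Function.update X k y) := hAf.comp hu
  set b := ENNReal.ofReal (w * Real.exp (-β * osc N E))
  calc b * c * ∫⁻ y in E, f (Function.update X k y)
      = c * ∫⁻ y in E, b * f (Function.update X k y) := by
        rw [lintegral_const_mul _ hfu]; ring
    _ ≤ c * ∫⁻ y in E, ENNReal.ofReal (moveProb γ k X) *
          (acceptMass E γ V β τ k (X, Function.update X k y) * f (Function.update X k y)) := by
        refine mul_le_mul_right (setLIntegral_mono' hE fun y hy => ?_) c
        rw [← mul_assoc]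
        exact mul_le_mul_left (le_moveProb_mul_acceptMass hN hE_bdd hγ hV hβ hτ hw0 hw k hX
          (update_mem_designsIn hX k hy)) _
    _ = ENNReal.ofReal (moveProb γ k X) * ∫⁻ y, acceptMass E γ V β τ k
          (X, Function.update X k y) * f (Function.update X k y) ∂(c • volume.restrict E) := by
        rw [lintegral_const_mul _ hAfu, lintegral_smul_measure,
          smul_eq_mul]
        ring
    _ ≤ ENNReal.ofReal (moveProb γ k X) * ∫⁻ Y, acceptMass E γ V β τ k (X, Y) * f Y
          ∂(proposal V τ k X) := by
        rw [lintegral_proposal V τ k X hAf]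
        exact mul_le_mul_right (lintegral_mono' (hc _ (hX k)) le_rfl) _
    _ ≤ ENNReal.ofReal (moveProb γ k X) * ∫⁻ Y, f Y ∂(move hE γ V β τ k X) := by
        rw [lintegral_move hE γ V β τ k X hf]
        exact mul_le_mul_right le_self_add _
    _ ≤ _ := by
        rw [lintegral_stepKernel]
        exact Finset.single_le_sum
          (f := fun k => ENNReal.ofReal (moveProb γ k X) * ∫⁻ Y, f Y ∂(move hE γ V β τ k X))
          (fun _ _ => zero_le) (Finset.mem_univ k)

end Minorization

/-! ### Kernels over several consecutive iterations. -/

section Blocks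

/-- The transition kernel from time `n` to time `n + j` of the chain with kernels `P`. -/
noncomputable def blockKernel {α : Type*} [MeasurableSpace α] (P : ℕ → Kernel α α) :
    ℕ → ℕ → Kernel α α
  | _, 0 => Kernel.id
  | n, j + 1 => blockKernel P (n + 1) j ∘ₖ P n

instance {α : Type*} [MeasurableSpace α] (P : ℕ → Kernel α α) [∀ n, IsMarkovKernel (P n)]
    (n j : ℕ) : IsMarkovKernel (blockKernel P n j) := by
  induction j generalizing n with
  | zero => unfold blockKernel; infer_instance
  | succ j ih => have := ih (n + 1); unfold blockKernel; infer_instance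

theorem bind_blockKernel_succ {α : Type*} [MeasurableSpace α] (P : ℕ → Kernel α α) (n j : ℕ)
    (μ : Measure α) :
    μ.bind (blockKernel P n (j + 1)) = (μ.bind (P n)).bind (blockKernel P (n + 1) j) := by
  rw [blockKernel]
  exact Measure.comp_assoc.symm

theorem bind_blockKernel {α : Type*} [MeasurableSpace α] {P : ℕ → Kernel α α}
    {μ : ℕ → Measure α} (hμ : ∀ n, μ (n + 1) = (μ n).bind (P n)) (n j : ℕ) :
    (μ n).bind (blockKernel P n j) = μ (n + j) := by
  induction j generalizing n with
  | zero => rw [blockKernel]; exact Measure.id_comp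
  | succ j ih => rw [bind_blockKernel_succ, ← hμ, ih, add_right_comm, add_assoc]

/-- Each law is invariant under its own kernel, so only the changes of law between steps cost a
factor, and these exponents telescope. -/
theorem bind_blockKernel_le {α : Type*} [MeasurableSpace α] {P : ℕ → Kernel α α}
    {π : ℕ → Measure α} (hπ : ∀ n, (π n).bind (P n) = π n) {b : ℕ → ℝ}
    (hb : ∀ n, π n ≤ ENNReal.ofReal (Real.exp (b (n + 1) - b n)) • π (n + 1)) (n j : ℕ) :
    (π n).bind (blockKernel P n j) ≤ ENNReal.ofReal (Real.exp (b (n + j) - b n)) • π (n + j) := by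
  induction j generalizing n with
  | zero => rw [blockKernel, show (π n).bind (Kernel.id) = π n from Measure.id_comp]; simp
  | succ j ih =>
    rw [bind_blockKernel_succ, hπ]
    refine Measure.le_iff.2 fun A hA => ?_
    have h1 := ih (n + 1) A
    rw [add_right_comm, add_assoc] at h1
    rw [Measure.bind_apply hA (Kernel.aemeasurable _), Measure.smul_apply, smul_eq_mul] at *
    calc ∫⁻ x, blockKernel P (n + 1) j x A ∂(π n)
        ≤ ∫⁻ x, blockKernel P (n + 1) j x A
            ∂(ENNReal.ofReal (Real.exp (b (n + 1) - b n)) • π (n + 1)) :=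
          lintegral_mono' (hb n) le_rfl
      _ ≤ ENNReal.ofReal (Real.exp (b (n + 1) - b n)) *
          (ENNReal.ofReal (Real.exp (b (n + (j + 1)) - b (n + 1))) * π (n + (j + 1)) A) := by
          rw [lintegral_smul_measure, smul_eq_mul]
          gcongr
      _ = _ := by
          rw [← mul_assoc, ← ENNReal.ofReal_mul (Real.exp_pos _).le, ← Real.exp_add]
          congr 3
          ring_nf

/-- The coordinates in `s` are resampled one per iteration. The chain stays in `E^N`, so the
one-step bound remains available; the horizon `M` lets a single constant `a` serve for all these
times. -/
theorem le_lintegral_blockKernel {d N : ℕ} {E : Set (Point d)}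
    {P : ℕ → Kernel (Design d N) (Design d N)} {a : ENNReal} {M : ℕ}
    (hP : ∀ n < M, ∀ k, ∀ X ∈ designsIn N E, ∀ f : Design d N → ENNReal, Measurable f →
      a * ∫⁻ y in E, f (Function.update X k y) ≤ ∫⁻ Y, f Y ∂(P n X))
    (hPE : ∀ n, ∀ X ∈ designsIn N E, P n X (designsIn N E)ᶜ = 0)
    (s : Finset (Fin N)) {n : ℕ} (hn : n + s.card ≤ M) {X : Design d N}
    (hX : X ∈ designsIn N E) {f : Design d N → ENNReal} (hf : Measurable f) :
    a ^ s.card * (∫⋯∫⁻_s, f ∂(fun _ => volume.restrict E)) X ≤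
      ∫⁻ Y, f Y ∂(blockKernel P n s.card X) := by
  induction s using Finset.induction_on generalizing n X with
  | empty => simp [blockKernel, Kernel.id_apply, lintegral_dirac' _ hf]
  | insert i s hi ih =>
    rw [Finset.card_insert_of_notMem hi] at hn ⊢
    have hm : Measurable (∫⋯∫⁻_s, f ∂(fun _ => volume.restrict E)) := hf.lmarginal _
    rw [lmarginal_insert _ hf hi, blockKernel, Kernel.lintegral_comp _ _ _ hf, pow_succ,
      mul_assoc]
    calc _ ≤ a ^ s.card * ∫⁻ Y, (∫⋯∫⁻_s, f ∂(fun _ => volume.restrict E)) Y ∂(P n X) :=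
          mul_le_mul_right (hP n (by omega) i X hX _ hm) _
      _ = ∫⁻ Y, a ^ s.card * (∫⋯∫⁻_s, f ∂(fun _ => volume.restrict E)) Y ∂(P n X) :=
          (lintegral_const_mul _ hm).symm
      _ ≤ _ := by
          refine lintegral_mono_ae ?_
          have h0 : ∀ᵐ Y ∂(P n X), Y ∈ designsIn N E := hPE n X hX
          exact h0.mono fun Y hY => ih (by omega) hY

/-- Once all `N` coordinates are resampled, nothing of the starting design remains: this is the
Doeblin condition. -/
theorem smul_restrict_le_blockKernel {d N : ℕ} {E : Set (Point d)}
    {P : ℕ → Kernel (Design d N) (Design d N)} {a : ENNReal} {n : ℕ}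
    (hP : ∀ m < n + N, ∀ k, ∀ X ∈ designsIn N E, ∀ f : Design d N → ENNReal, Measurable f →
      a * ∫⁻ y in E, f (Function.update X k y) ≤ ∫⁻ Y, f Y ∂(P m X))
    (hPE : ∀ n, ∀ X ∈ designsIn N E, P n X (designsIn N E)ᶜ = 0)
    {X : Design d N} (hX : X ∈ designsIn N E) :
    a ^ N • volume.restrict (designsIn N E) ≤ blockKernel P n N X := by
  refine Measure.le_iff.2 fun A hA => ?_
  have h := le_lintegral_blockKernel hP hPE Finset.univ (n := n) (by simp) hX
    (measurable_one.indicator hA)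
  have hpi : Measure.pi (fun _ : Fin N => volume.restrict E) =
      volume.restrict (designsIn N E) := by
    rw [← Measure.restrict_pi_pi, ← volume_pi]
    congr 1
    ext X; simp [designsIn]
  simpa [lmarginal_univ, lintegral_indicator_one hA, hpi] using h

end Blocks

/-! ### Gibbs laws: normalization, dependence on `β`, concentration. -/

section Gibbs

variable {d N : ℕ}

theorem volume_designsIn (E : Set (Point d)) :
    volume (designsIn N E) = volume E ^ N := by
  have : designsIn N E = Set.univ.pi fun _ => E := by ext X; simp [designsIn]
  rw [this, volume_pi, Measure.pi_pi]; simp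

theorem volume_designsIn_pos {E : Set (Point d)} (hE_pos : 0 < volume E) :
    0 < volume (designsIn N E) := by
  rw [volume_designsIn]; exact (pow_ne_zero N hE_pos.ne').bot_lt

theorem volume_designsIn_lt_top {E : Set (Point d)} (hE_bdd : Bornology.IsBounded E) :
    volume (designsIn N E) < ⊤ := by
  rw [volume_designsIn]; exact ENNReal.pow_lt_top hE_bdd.measure_lt_top

theorem gibbsMeasure_compl_designsIn {E : Set (Point d)} (hE : MeasurableSet E) (β : ℝ) :
    gibbsMeasure N E β (designsIn N E)ᶜ = 0 := by
  have hS := measurableSet_designsIn (N := N) hE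
  rw [gibbsMeasure, withDensity_apply _ hS.compl]
  refine (setLIntegral_congr_fun hS.compl (g := fun _ => 0) fun X hX => ?_).trans (by simp)
  exact if_neg hX

theorem gibbsMeasure_univ_pos {E : Set (Point d)} (hE : MeasurableSet E)
    (hE_pos : 0 < volume E) (β : ℝ) : 0 < gibbsMeasure N E β Set.univ := by
  rw [gibbsMeasure, withDensity_apply _ MeasurableSet.univ, Measure.restrict_univ,
    lintegral_pos_iff_support (measurable_gibbsWeight hE β)]
  refine (volume_designsIn_pos hE_pos).trans_le (measure_mono fun X hX => ?_)
  rw [Function.mem_support, gibbsWeight, if_pos hX]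
  simp [Real.exp_pos]

theorem gibbsMeasure_univ_lt_top (hN : 2 ≤ N) {E : Set (Point d)}
    (hE_bdd : Bornology.IsBounded E) (hE : MeasurableSet E) {β : ℝ} (hβ : 0 ≤ β) :
    gibbsMeasure N E β Set.univ < ⊤ := by
  have hS := measurableSet_designsIn (N := N) hE
  calc gibbsMeasure N E β Set.univ
      = ∫⁻ X, gibbsWeight E β X := by
        rw [gibbsMeasure, withDensity_apply _ MeasurableSet.univ, Measure.restrict_univ]
    _ ≤ ∫⁻ X, (designsIn N E).indicator (fun _ => 1) X := by
        refine lintegral_mono fun X => ?_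
        by_cases hX : X ∈ designsIn N E
        · have := separation_le hN hE_bdd hX
          rw [gibbsWeight, if_pos hX, Set.indicator_of_mem hX, ← ENNReal.ofReal_one]
          refine ENNReal.ofReal_le_ofReal (Real.exp_le_one_iff.2 ?_)
          have : 0 ≤ energy E X := sub_nonneg.2 this
          nlinarith
        · rw [gibbsWeight, if_neg hX]; exact zero_le
    _ = volume (designsIn N E) := lintegral_indicator_one hS
    _ < ⊤ := volume_designsIn_lt_top hE_bdd

/-- The Gibbs law on `E^N` at inverse temperature `β`. -/
noncomputable def gibbsLaw (N : ℕ) (E : Set (Point d)) (β : ℝ) : Measure (Design d N) :=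
  (gibbsMeasure N E β Set.univ)⁻¹ • gibbsMeasure N E β

theorem isProbabilityMeasure_gibbsLaw (hN : 2 ≤ N) {E : Set (Point d)}
    (hE_bdd : Bornology.IsBounded E) (hE : MeasurableSet E) (hE_pos : 0 < volume E) {β : ℝ}
    (hβ : 0 ≤ β) : IsProbabilityMeasure (gibbsLaw N E β) :=
  ⟨by
    rw [gibbsLaw, Measure.smul_apply, smul_eq_mul]
    exact ENNReal.inv_mul_cancel (gibbsMeasure_univ_pos hE hE_pos β).ne'
      (gibbsMeasure_univ_lt_top hN hE_bdd hE hβ).ne⟩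

theorem gibbsLaw_bind_stepKernel (hN : 2 ≤ N) {E : Set (Point d)} (hE : MeasurableSet E)
    {γ : ℝ} (hγ : 0 < γ) {V : Matrix (Fin d) (Fin d) ℝ} (hV : V.PosDef) (β : ℝ) {τ : ℝ}
    (hτ : 0 < τ) :
    (gibbsLaw N E β).bind (stepKernel hN hE hγ V β τ) = gibbsLaw N E β := by
  have h := gibbsMeasure_bind_stepKernel hN hE hγ hV β hτ
  refine Measure.ext fun A hA => ?_
  have hA' := congrArg (fun μ => μ A) h
  rw [Measure.bind_apply hA (Kernel.aemeasurable _)] at hA' ⊢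
  rw [gibbsLaw, lintegral_smul_measure, Measure.smul_apply, hA']

theorem gibbsWeight_mul_le (hN : 2 ≤ N) {E : Set (Point d)} (hE_bdd : Bornology.IsBounded E)
    {β β' : ℝ} (hβ : β ≤ β') (X Y : Design d N) :
    gibbsWeight E β' Y * gibbsWeight E β X ≤
      ENNReal.ofReal (Real.exp ((β' - β) * osc N E)) *
        (gibbsWeight E β Y * gibbsWeight E β' X) := by
  unfold gibbsWeight
  split_ifs with hY hX
  · rw [← ENNReal.ofReal_mul (Real.exp_pos _).le, ← ENNReal.ofReal_mul (Real.exp_pos _).le,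
      ← ENNReal.ofReal_mul (Real.exp_pos _).le, ← Real.exp_add, ← Real.exp_add, ← Real.exp_add]
    refine ENNReal.ofReal_le_ofReal (Real.exp_le_exp.2 ?_)
    have := mul_le_mul_of_nonneg_left ((osc_spec hN hE_bdd).2 Y hY X hX) (sub_nonneg.2 hβ)
    linarith
  all_goals simp

/-- Integrating the crossed inequality `gibbsWeight_mul_le` over `Y` brings in both normalizing
constants, so only the oscillation of `U` enters. -/
theorem gibbsLaw_le_smul (hN : 2 ≤ N) {E : Set (Point d)} (hE_bdd : Bornology.IsBounded E)
    (hE : MeasurableSet E) (hE_pos : 0 < volume E) {β β' : ℝ} (hβ0 : 0 ≤ β) (hβ : β ≤ β') :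
    gibbsLaw N E β ≤ ENNReal.ofReal (Real.exp ((β' - β) * osc N E)) • gibbsLaw N E β' := by
  have hm := fun β => measurable_gibbsWeight (N := N) hE β
  set e := ENNReal.ofReal (Real.exp ((β' - β) * osc N E))
  have hZ : ∀ β, gibbsMeasure N E β Set.univ = ∫⁻ Y, gibbsWeight E β Y := fun β => by
    rw [gibbsMeasure, withDensity_apply _ MeasurableSet.univ, Measure.restrict_univ]
  have hp := fun β => (gibbsMeasure_univ_pos (N := N) hE hE_pos β).ne'
  have ht := (gibbsMeasure_univ_lt_top hN hE_bdd hE hβ0).ne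
  have ht' := (gibbsMeasure_univ_lt_top hN hE_bdd hE (hβ0.trans hβ)).ne
  have h1 : ∀ X : Design d N, gibbsMeasure N E β' Set.univ * gibbsWeight E β X ≤
      e * gibbsMeasure N E β Set.univ * gibbsWeight E β' X := by
    intro X
    rw [hZ, hZ, ← lintegral_mul_const _ (hm β'), mul_assoc, ← lintegral_mul_const _ (hm β),
      ← lintegral_const_mul _ ((hm β).mul_const _)]
    exact lintegral_mono fun Y => gibbsWeight_mul_le hN hE_bdd hβ X Y
  refine Measure.le_iff.2 fun A hA => ?_
  have h2 : gibbsMeasure N E β' Set.univ * gibbsMeasure N E β A ≤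
      e * gibbsMeasure N E β Set.univ * gibbsMeasure N E β' A := by
    conv_lhs => rw [gibbsMeasure.eq_1 N E β, withDensity_apply _ hA]
    conv_rhs => rw [gibbsMeasure.eq_1 N E β', withDensity_apply _ hA]
    rw [← lintegral_const_mul _ (hm β), ← lintegral_const_mul _ (hm β')]
    exact lintegral_mono h1
  rw [Measure.smul_apply, gibbsLaw, gibbsLaw, Measure.smul_apply, Measure.smul_apply,
    smul_eq_mul, smul_eq_mul, smul_eq_mul]
  have hp0 := hp β
  have hp' := hp β'
  clear hZ hp h1
  generalize gibbsMeasure N E β Set.univ = Z at *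
  generalize gibbsMeasure N E β' Set.univ = Z' at *
  calc Z⁻¹ * gibbsMeasure N E β A = Z⁻¹ * Z'⁻¹ * (Z' * gibbsMeasure N E β A) := by
        rw [mul_assoc, ← mul_assoc Z'⁻¹, ENNReal.inv_mul_cancel hp' ht', one_mul]
    _ ≤ Z⁻¹ * Z'⁻¹ * (e * Z * gibbsMeasure N E β' A) := by gcongr
    _ = (Z⁻¹ * Z) * (e * (Z'⁻¹ * gibbsMeasure N E β' A)) := by ring
    _ = _ := by rw [ENNReal.inv_mul_cancel hp0 ht, one_mul]

theorem measurableSet_nearOptimal {E : Set (Point d)} (hE : MeasurableSet E) (ε : ℝ) :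
    MeasurableSet (nearOptimal N E ε) :=
  (measurableSet_designsIn hE).inter (measurableSet_le (measurable_energy E) measurable_const)

theorem volume_energy_lt_pos {E : Set (Point d)}
    (hE_pos : 0 < volume E) {a : ℝ} (ha : essMin N E < a) :
    0 < volume ({X : Design d N | energy E X < a} ∩ designsIn N E) := by
  rw [← Measure.restrict_apply (measurableSet_lt (measurable_energy E) measurable_const)]
  -- The supremum defining `essMin` is over a set bounded above: a level beyond `diam(E)` has all of
  -- `E^N` below it, which has positive measure.
  refine bot_lt_iff_ne_bot.2 fun h => ha.not_ge (le_csSup ⟨Metric.diam E + 1, ?_⟩ h)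
  intro b hb
  by_contra! hlt
  have huniv : {X : Design d N | energy E X < b} = Set.univ := by
    refine Set.eq_univ_of_forall fun X => ?_
    have := separation_nonneg X
    rw [Set.mem_ofPred_eq, energy]
    linarith
  rw [Set.mem_ofPred_eq, huniv, Measure.restrict_apply_univ] at hb
  exact (volume_designsIn_pos hE_pos).ne' hb

/-- The weight off the near-optimal set is at most `e^{-b(m+ε)}`, while the designs with `U < m +
ε/2` have positive volume `q` and weight at least `e^{-b(m+ε/2)}`; the quotient decays like
`e^{-bε/2}`. -/
theorem tendsto_gibbsLaw_compl_nearOptimal {E : Set (Point d)}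
    (hE_bdd : Bornology.IsBounded E) (hE : MeasurableSet E) (hE_pos : 0 < volume E) {β : ℕ → ℝ}
    (hβ0 : ∀ n, 0 ≤ β n) (hβ : Tendsto β atTop atTop) {ε : ℝ} (hε : 0 < ε) :
    Tendsto (fun n => gibbsLaw N E (β n) (nearOptimal N E ε)ᶜ) atTop (𝓝 0) := by
  have hS := measurableSet_designsIn (N := N) hE
  set m := essMin N E with hm
  set q := volume ({X : Design d N | energy E X < m + ε / 2} ∩ designsIn N E) with hq
  have hq0 : 0 < q := volume_energy_lt_pos hE_pos (by linarith)
  have hqt : q ≠ ⊤ := ((measure_mono Set.inter_subset_right).trans_lt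
    (volume_designsIn_lt_top hE_bdd)).ne
  have hbound : ∀ b, 0 ≤ b → gibbsLaw N E b (nearOptimal N E ε)ᶜ ≤
      ENNReal.ofReal (Real.exp (-(b * (ε / 2)))) * (q⁻¹ * volume (designsIn N E)) := by
    intro b hb
    have h1 : gibbsMeasure N E b (nearOptimal N E ε)ᶜ ≤
        ENNReal.ofReal (Real.exp (-b * (m + ε))) * volume (designsIn N E) := by
      rw [gibbsMeasure, withDensity_apply _ (measurableSet_nearOptimal hE ε).compl,
        ← setLIntegral_const, ← lintegral_indicator hS,
        ← lintegral_indicator (measurableSet_nearOptimal hE ε).compl]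
      refine lintegral_mono fun X => ?_
      by_cases hX : X ∈ designsIn N E
      · rw [Set.indicator_of_mem hX]
        by_cases hX' : X ∈ nearOptimal N E ε
        · rw [Set.indicator_of_notMem (Set.notMem_compl_iff.2 hX')]; exact zero_le
        · rw [Set.indicator_of_mem hX', gibbsWeight, if_pos hX]
          refine ENNReal.ofReal_le_ofReal (Real.exp_le_exp.2 ?_)
          have : m + ε < energy E X := lt_of_not_ge fun h => hX' ⟨hX, h⟩
          nlinarith
      · have : gibbsWeight E b X = 0 := if_neg hX
        refine (Set.indicator_le_self _ _ X).trans ?_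
        rw [this]; exact zero_le
    have h2 : ENNReal.ofReal (Real.exp (-b * (m + ε / 2))) * q ≤ gibbsMeasure N E b Set.univ := by
      refine le_trans ?_ (measure_mono (Set.subset_univ
        ({X : Design d N | energy E X < m + ε / 2} ∩ designsIn N E)))
      have hms : MeasurableSet ({X : Design d N | energy E X < m + ε / 2} ∩ designsIn N E) :=
        (measurableSet_lt (measurable_energy E) measurable_const).inter hS
      rw [gibbsMeasure, withDensity_apply _ hms, ← setLIntegral_const]
      refine setLIntegral_mono' hms fun X hX => ?_
      rw [gibbsWeight, if_pos hX.2]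
      refine ENNReal.ofReal_le_ofReal (Real.exp_le_exp.2 ?_)
      have : energy E X ≤ m + ε / 2 := le_of_lt hX.1
      nlinarith
    rw [gibbsLaw, Measure.smul_apply, smul_eq_mul]
    calc _ ≤ (ENNReal.ofReal (Real.exp (-b * (m + ε / 2))) * q)⁻¹ *
          (ENNReal.ofReal (Real.exp (-b * (m + ε))) * volume (designsIn N E)) := by gcongr
      _ = _ := by
          rw [ENNReal.mul_inv (Or.inr hqt) (Or.inr hq0.ne'),
            ← ENNReal.ofReal_inv_of_pos (Real.exp_pos _), ← Real.exp_neg]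
          rw [show ∀ x y z w : ENNReal, x * y * (z * w) = x * z * (y * w) from
            fun x y z w => by ring, ← ENNReal.ofReal_mul (Real.exp_pos _).le, ← Real.exp_add]
          congr 3
          ring_nf
  have hlim : Tendsto (fun n => ENNReal.ofReal (Real.exp (-(β n * (ε / 2)))) *
      (q⁻¹ * volume (designsIn N E))) atTop (𝓝 0) := by
    have h1 : Tendsto (fun n => ENNReal.ofReal (Real.exp (-(β n * (ε / 2))))) atTop (𝓝 0) := by
      rw [← ENNReal.ofReal_zero]
      exact ENNReal.tendsto_ofReal (Real.tendsto_exp_neg_atTop_nhds_zero.comp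
        (hβ.atTop_mul_const (half_pos hε)))
    have h2 : q⁻¹ * volume (designsIn N E) ≠ ⊤ :=
      ENNReal.mul_ne_top (ENNReal.inv_ne_top.2 hq0.ne') (volume_designsIn_lt_top hE_bdd).ne
    simpa using ENNReal.Tendsto.mul_const h1 (Or.inr h2)
  exact tendsto_of_tendsto_of_tendsto_of_le_of_le tendsto_const_nhds hlim
    (fun _ => zero_le) fun n => hbound _ (hβ0 n)

end Gibbs

/-! ### One-time marginals of the trajectory law. -/

section Marginals

variable {α : Type*} [MeasurableSpace α]

theorem trajMeasure_map_zero (η : Measure α) (κ : (n : ℕ) → Kernel (Finset.Iic n → α) α)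
    [∀ n, IsMarkovKernel (κ n)] :
    (Kernel.trajMeasure (X := fun _ => α) η κ).map (fun x => x 0) = η := by
  have h0 : (fun x : ℕ → α => x 0) =
      (fun x : Finset.Iic 0 → α => x ⟨0, Finset.mem_Iic.2 le_rfl⟩) ∘
        Preorder.frestrictLe (π := fun _ => α) 0 := rfl
  have hm : Measurable fun x : Finset.Iic 0 → α => x ⟨0, Finset.mem_Iic.2 le_rfl⟩ :=
    measurable_pi_apply _
  rw [h0, ← Measure.map_map hm (Preorder.measurable_frestrictLe 0), Kernel.trajMeasure,
    Measure.map_comp _ _ (Preorder.measurable_frestrictLe 0), Kernel.traj_map_frestrictLe,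
    Kernel.partialTraj_self, Measure.id_comp, Measure.map_map hm (by fun_prop)]
  exact Measure.map_id

theorem trajMeasure_map_succ (η : Measure α) [IsProbabilityMeasure η] (P : ℕ → Kernel α α)
    [∀ n, IsMarkovKernel (P n)] (n : ℕ) :
    let μ := Kernel.trajMeasure (X := fun _ => α) η fun n => (P n).comap
      (fun x : (i : Finset.Iic n) → α => x ⟨n, Finset.mem_Iic.2 le_rfl⟩) (measurable_pi_apply _)
    μ.map (fun x => x (n + 1)) = (μ.map (fun x => x n)).bind (P n) := by
  intro μ
  have h := Kernel.map_frestrictLe_trajMeasure_compProd_eq_map_trajMeasure (X := fun _ => α)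
    (μ₀ := η) (κ := fun n => (P n).comap
      (fun x : (i : Finset.Iic n) → α => x ⟨n, Finset.mem_Iic.2 le_rfl⟩)
      (measurable_pi_apply _)) (a := n)
  change Measure.map _ μ ⊗ₘ _ = Measure.map _ μ at h
  have h2 := congrArg Measure.snd h
  rw [Measure.snd_compProd, Measure.snd, Measure.map_map (by fun_prop) (by fun_prop)] at h2
  change _ = μ.map (fun x => x (n + 1)) at h2
  rw [← h2]
  refine Measure.ext fun A hA => ?_
  rw [Measure.bind_apply hA (Kernel.aemeasurable _), Measure.bind_apply hA (Kernel.aemeasurable _),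
    lintegral_map ((Kernel.measurable_coe _ hA)) (by fun_prop),
    lintegral_map ((Kernel.measurable_coe _ hA)) (by fun_prop)]
  rfl

end Marginals

/-! ### Divergence of the gains and comparison with the drift. -/

section Rates

theorem tendsto_sum_rpow_neg {a κ : ℝ} (ha1 : a ≤ 1) (hκ : 0 < κ) {N r : ℕ} (hr : r < N) :
    Tendsto (fun k => ∑ i ∈ Finset.range k,
      κ * (((r + i * N : ℕ) : ℝ) + Real.exp 1 + N) ^ (-a)) atTop atTop := by
  have hN0 : (0 : ℝ) ≤ N := Nat.cast_nonneg N
  have he : Real.exp 1 < 3 := Real.exp_one_lt_three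
  have he1 : 1 < Real.exp 1 := Real.one_lt_exp_iff.2 one_pos
  have hpos : (0 : ℝ) < κ / (2 * N + 3) := by positivity
  refine tendsto_atTop_mono (fun k => ?_)
    (Real.tendsto_sum_range_one_div_nat_succ_atTop.const_mul_atTop hpos)
  rw [Finset.mul_sum]
  refine Finset.sum_le_sum fun i _ => ?_
  have hi0 : (0 : ℝ) ≤ (r + i * N : ℕ) := Nat.cast_nonneg _
  have hrN : (r : ℝ) ≤ N := by exact_mod_cast hr.le
  -- Comparison with the harmonic series, using `r ≤ N` and `exp 1 < 3`.
  have hx : ((r + i * N : ℕ) : ℝ) + Real.exp 1 + N ≤ (2 * N + 3) * ((i : ℝ) + 1) := by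
    push_cast
    have : (0 : ℝ) ≤ i := Nat.cast_nonneg i
    nlinarith
  calc κ / (2 * N + 3) * (1 / ((i : ℝ) + 1)) = κ * ((2 * N + 3) * ((i : ℝ) + 1))⁻¹ := by
        field_simp
    _ ≤ κ * (((r + i * N : ℕ) : ℝ) + Real.exp 1 + N)⁻¹ := by gcongr
    _ ≤ _ := by
        rw [← Real.rpow_neg_one]
        gcongr
        linarith

/-- For `x ≥ 1`, `x + N ≤ (N + 1) x`, so the right-hand side is at least a constant times `x^{-a}`,
which outweighs `a/x` because `a < 1`. -/
theorem eventually_div_le_rpow_neg {a κ δ : ℝ} (ha0 : 0 ≤ a) (ha1 : a < 1) (hκ : 0 < κ)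
    (hδ : 0 < δ) {N : ℕ} : ∀ᶠ x : ℝ in atTop, a / x ≤ δ * (κ * (x + N) ^ (-a)) := by
  have hc : 0 < δ * (κ * ((N : ℝ) + 1) ^ (-a)) := by positivity
  have h := ((tendsto_rpow_atTop (sub_pos.2 ha1)).const_mul_atTop hc).eventually_ge_atTop a
  filter_upwards [h, eventually_ge_atTop 1] with x hx hx1
  have hx0 : 0 < x := by linarith
  have hN0 : (0 : ℝ) ≤ N := Nat.cast_nonneg N
  rw [div_le_iff₀ hx0]
  calc a ≤ δ * (κ * ((N : ℝ) + 1) ^ (-a)) * x ^ (1 - a) := hx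
    _ = δ * (κ * (((N : ℝ) + 1) * x) ^ (-a)) * x := by
        rw [Real.mul_rpow (by positivity) hx0.le, sub_eq_add_neg, Real.rpow_add hx0,
          Real.rpow_one]
        ring
    _ ≤ _ := by
        gcongr ?_ * x
        refine mul_le_mul_of_nonneg_left (mul_le_mul_of_nonneg_left ?_ hκ.le) hδ.le
        refine Real.rpow_le_rpow_of_nonpos (by positivity) ?_ (by linarith)
        nlinarith

end Rates

/-! ### Logarithmic cooling and conclusion. -/

section Convergence

variable {d N : ℕ}

theorem logSchedule_pos {C : ℝ} (hC : 0 < C) (n : ℕ) :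
    0 < 1 / C * Real.log ((n : ℝ) + Real.exp 1) := by
  have he1 : 1 < Real.exp 1 := Real.one_lt_exp_iff.2 one_pos
  have hn : (0 : ℝ) ≤ n := Nat.cast_nonneg n
  exact mul_pos (by positivity) (Real.log_pos (by linarith))

theorem logSchedule_mono {C : ℝ} (hC : 0 < C) :
    Monotone fun n : ℕ => 1 / C * Real.log ((n : ℝ) + Real.exp 1) := by
  intro m n hmn
  have h : (m : ℝ) ≤ n := by exact_mod_cast hmn
  have := Real.exp_pos 1
  dsimp only
  gcongr

theorem tendsto_logSchedule {C : ℝ} (hC : 0 < C) :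
    Tendsto (fun n : ℕ => 1 / C * Real.log ((n : ℝ) + Real.exp 1)) atTop atTop :=
  (Real.tendsto_log_atTop.comp
    (tendsto_atTop_add_const_right _ _ tendsto_natCast_atTop_atTop)).const_mul_atTop
    (by positivity)

theorem logSchedule_sub_le {C : ℝ} (hC : 0 < C) (n N : ℕ) :
    1 / C * Real.log (((n + N : ℕ) : ℝ) + Real.exp 1) - 1 / C * Real.log ((n : ℝ) + Real.exp 1) ≤
      N / C / ((n : ℝ) + Real.exp 1) := by
  have hx : 0 < (n : ℝ) + Real.exp 1 :=
    add_pos_of_nonneg_of_pos (Nat.cast_nonneg n) (Real.exp_pos 1)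
  have hN : (0 : ℝ) ≤ N := Nat.cast_nonneg N
  rw [← mul_sub, ← Real.log_div (by push_cast; positivity) hx.ne']
  have h := Real.log_le_sub_one_of_pos
    (show 0 < (((n + N : ℕ) : ℝ) + Real.exp 1) / ((n : ℝ) + Real.exp 1) by positivity)
  calc _ ≤ 1 / C * ((((n + N : ℕ) : ℝ) + Real.exp 1) / ((n : ℝ) + Real.exp 1) - 1) := by gcongr
    _ = _ := by push_cast; field_simp; ring

theorem exp_neg_logSchedule {C o : ℝ} (n N : ℕ) :
    Real.exp (-(1 / C * Real.log ((n : ℝ) + Real.exp 1)) * o) ^ N =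
      ((n : ℝ) + Real.exp 1) ^ (-(N * o / C)) := by
  have hx : 0 < (n : ℝ) + Real.exp 1 :=
    add_pos_of_nonneg_of_pos (Nat.cast_nonneg n) (Real.exp_pos 1)
  rw [← Real.exp_nat_mul, Real.rpow_def_of_pos hx]
  congr 1
  ring

theorem exists_overlap_rate {α : Type*} [MeasurableSpace α] {μ π : ℕ → Measure α} {N : ℕ}
    {e s : ℕ → ℝ} (he1 : ∀ n, e n ≤ 1) (hs0 : ∀ n, 0 ≤ s n)
    (h : ∀ n t, 0 ≤ t → HasOverlap (μ n) (π n) t →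
      HasOverlap (μ (n + N)) (π (n + N)) ((1 - e n) * t + s n)) {r : ℕ}
    (hsum : Tendsto (fun k => ∑ i ∈ Finset.range k, e (r + i * N)) atTop atTop)
    (hs : ∀ δ : ℝ, 0 < δ → ∀ᶠ k in atTop, s (r + k * N) ≤ δ * e (r + k * N)) :
    ∃ u : ℕ → ℝ, Tendsto u atTop (𝓝 0) ∧
      ∀ k, HasOverlap (μ (r + k * N)) (π (r + k * N)) (u k) := by
  -- The recursion starts from defect `1`, which holds for any two measures.
  obtain ⟨u, hu0, hu⟩ : ∃ u : ℕ → ℝ, u 0 = 1 ∧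
      ∀ k, u (k + 1) = (1 - e (r + k * N)) * u k + s (r + k * N) :=
    ⟨fun k => Nat.rec 1 (fun k v => (1 - e (r + k * N)) * v + s (r + k * N)) k, rfl, fun _ => rfl⟩
  have hnn : ∀ k, 0 ≤ u k := by
    intro k
    induction k with
    | zero => rw [hu0]; exact zero_le_one
    | succ k ih =>
      rw [hu]
      exact add_nonneg (mul_nonneg (sub_nonneg.2 (he1 _)) ih) (hs0 _)
  refine ⟨u, tendsto_zero_of_contraction hnn (fun _ => he1 _) (fun k => (hu k).le) hsum hs,
    fun k => ?_⟩
  induction k with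
  | zero => rw [hu0]; exact hasOverlap_one _ _
  | succ k ih =>
    rw [hu, add_mul, one_mul, ← add_assoc]
    exact h _ _ (hnn k) ih

/-- The probability of the near-optimal set tends to `1` along a subsequence on which the overlap
with the Gibbs laws tends to `1`. -/
theorem tendsto_one_of_overlap {α : Type*} [MeasurableSpace α] {μ π : ℕ → Measure α}
    [∀ n, IsProbabilityMeasure (μ n)] [∀ n, IsProbabilityMeasure (π n)] {u : ℕ → ℝ}
    (hu : Tendsto u atTop (𝓝 0)) (h : ∀ k, HasOverlap (μ k) (π k) (u k)) {A : Set α}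
    (hA : MeasurableSet A) (hπ : Tendsto (fun k => π k Aᶜ) atTop (𝓝 0)) :
    Tendsto (fun k => μ k A) atTop (𝓝 1) := by
  have h1 : Tendsto (fun k => ENNReal.ofReal (1 - u k) - π k Aᶜ) atTop (𝓝 1) := by
    have h2 : Tendsto (fun k => ENNReal.ofReal (1 - u k)) atTop (𝓝 1) := by
      have := ENNReal.tendsto_ofReal (hu.const_sub 1)
      simpa using this
    simpa using ENNReal.Tendsto.sub h2 hπ (Or.inl ENNReal.one_ne_top)
  exact tendsto_of_tendsto_of_tendsto_of_le_of_le h1 tendsto_const_nhds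
    (fun k => (h k).le_measure A hA) fun k => prob_le_one

theorem exists_minorization_rate (hN : 2 ≤ N) {E : Set (Point d)}
    (hE_bdd : Bornology.IsBounded E) (hE : MeasurableSet E) (hE_pos : 0 < volume E)
    {γ : ℝ} (hγ : 0 < γ) {V : Matrix (Fin d) (Fin d) ℝ} (hV : V.PosDef) {τ : ℕ → ℝ} {τmin : ℝ}
    (hτmin : 0 < τmin) (hτ : ∀ n, τ n ≤ τ 0 ∧ τmin ≤ τ n) {β : ℕ → ℝ} (hβ0 : ∀ n, 0 ≤ β n)
    (hβ : Monotone β) :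
    ∃ κ : ℝ, 0 < κ ∧ κ ≤ 1 ∧ ∀ n, ∃ ρ : Measure (Design d N),
      ENNReal.ofReal (κ * Real.exp (-β (n + N) * osc N E) ^ N) ≤ ρ Set.univ ∧
      ∀ X ∈ designsIn N E,
        ρ ≤ blockKernel (fun n => stepKernel hN hE hγ V (β n) (τ n)) n N X := by
  obtain ⟨w, hw0, hw1, hw⟩ := exists_le_moveProb hN hγ hE_bdd
  obtain ⟨c, hc0, hc1, hc⟩ := exists_smul_restrict_le_multivariateGaussian hE_bdd hV hτmin
    (hτ 0).2
  have ho := (osc_spec hN hE_bdd).1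
  set v := volume (designsIn N E) with hv
  have hv0 : v ≠ 0 := (volume_designsIn_pos hE_pos).ne'
  have hvt : v ≠ ⊤ := (volume_designsIn_lt_top hE_bdd).ne
  set K := (ENNReal.ofReal w * c) ^ N * v with hK
  have hKt : K ≠ ⊤ := ENNReal.mul_ne_top (ENNReal.pow_ne_top (ENNReal.mul_ne_top
    ENNReal.ofReal_ne_top (hc1.trans_lt ENNReal.one_lt_top).ne)) hvt
  have hK0 : K ≠ 0 := mul_ne_zero (pow_ne_zero _ (mul_ne_zero
    (ENNReal.ofReal_pos.2 hw0).ne' hc0.ne')) hv0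
  refine ⟨min 1 K.toReal, lt_min one_pos (ENNReal.toReal_pos hK0 hKt), min_le_left _ _,
    fun n => ?_⟩
  set x := Real.exp (-β (n + N) * osc N E) with hx
  have hx0 : 0 ≤ x := (Real.exp_pos _).le
  -- As `β` is monotone, the value at the end of the block gives the worst one-step constant, valid
  -- throughout the block.
  refine ⟨(ENNReal.ofReal (w * x) * c) ^ N • volume.restrict (designsIn N E), ?_, ?_⟩
  · rw [Measure.smul_apply, Measure.restrict_apply_univ, smul_eq_mul]
    calc _ ≤ ENNReal.ofReal (K.toReal * x ^ N) := by
          refine ENNReal.ofReal_le_ofReal ?_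
          gcongr
          exact min_le_right _ _
      _ = _ := by
          rw [ENNReal.ofReal_mul ENNReal.toReal_nonneg, ENNReal.ofReal_toReal hKt,
            ENNReal.ofReal_pow hx0, ENNReal.ofReal_mul hw0.le, hK]
          ring
  · intro X hX
    refine smul_restrict_le_blockKernel (fun m hm k X hX f hf => ?_)
      (fun n X hX => stepKernel_designsIn hN hE hγ V _ _ hX) hX
    have hτm := hτmin.trans_le (hτ m).2
    refine le_trans ?_ (le_lintegral_stepKernel hN hE_bdd hE hγ hV (hβ0 m) hτm hw0 hw
      (hc (τ m) (hτ m).2 (hτ m).1) k hX hf)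
    have := hβ hm.le
    rw [hx]
    gcongr

theorem tendsto_sequenceLaw_nearOptimal (hN : 2 ≤ N)
    (E : Set (Point d)) (hE_bdd : Bornology.IsBounded E)
    (hE : MeasurableSet E) (hE_pos : 0 < volume E)
    (γ : ℝ) (hγ : 0 < γ)
    (V : Matrix (Fin d) (Fin d) ℝ) (hV : V.PosDef)
    (τ : ℕ → ℝ) (τmin : ℝ) (hτmin : 0 < τmin) (hτ : ∀ n, τ n ≤ τ 0 ∧ τmin ≤ τ n)
    (C : ℝ) (hC : (N : ℝ) * osc N E < C)
    (β : ℕ → ℝ) (hβ : ∀ n : ℕ, β n = 1 / C * Real.log ((n : ℝ) + Real.exp 1))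
    (η : Measure (Design d N)) [IsProbabilityMeasure η]
    (hη : η (designsIn N E) = 1) :
    ∀ ε : ℝ, 0 < ε →
      Tendsto
        (fun n : ℕ => sequenceLaw hN hE hγ V β τ η
          {X | X n ∈ nearOptimal N E ε})
        atTop (𝓝 1) := by
  intro ε hε
  have hS := measurableSet_designsIn (N := N) hE
  have ho := (osc_spec hN hE_bdd).1
  have hN0 : (0 : ℝ) ≤ N := Nat.cast_nonneg N
  have hC0 : 0 < C := (mul_nonneg hN0 ho).trans_lt hC
  have hβeq : β = fun n : ℕ => 1 / C * Real.log ((n : ℝ) + Real.exp 1) := funext hβ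
  have hβ0 : ∀ n, 0 ≤ β n := fun n => by rw [hβ]; exact (logSchedule_pos hC0 n).le
  have hβm : Monotone β := by rw [hβeq]; exact logSchedule_mono hC0
  have hβt : Tendsto β atTop atTop := by rw [hβeq]; exact tendsto_logSchedule hC0
  have hτ0 : ∀ n, 0 < τ n := fun n => hτmin.trans_le (hτ n).2
  set P : ℕ → Kernel (Design d N) (Design d N) :=
    fun n => stepKernel hN hE hγ V (β n) (τ n) with hP
  have hPm : ∀ n, IsMarkovKernel (P n) := fun n => isMarkovKernel_stepKernel hN hE hγ V _ _
  set π : ℕ → Measure (Design d N) := fun n => gibbsLaw N E (β n) with hπ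
  set μ : ℕ → Measure (Design d N) :=
    fun n => (sequenceLaw hN hE hγ V β τ η).map (fun X => X n) with hμ
  have hseq : IsProbabilityMeasure (sequenceLaw hN hE hγ V β τ η) := by
    unfold sequenceLaw; infer_instance
  have hπp : ∀ n, IsProbabilityMeasure (π n) := fun n =>
    isProbabilityMeasure_gibbsLaw hN hE_bdd hE hE_pos (hβ0 n)
  have hμp : ∀ n, IsProbabilityMeasure (μ n) := fun n =>
    Measure.isProbabilityMeasure_map (measurable_pi_apply n).aemeasurable
  have hμ0 : μ 0 = η := trajMeasure_map_zero η _
  have hμs : ∀ n, μ (n + 1) = (μ n).bind (P n) := fun n => trajMeasure_map_succ η P n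
  have hπinv : ∀ n, (π n).bind (P n) = π n := fun n =>
    gibbsLaw_bind_stepKernel hN hE hγ hV (β n) (hτ0 n)
  have hμS : ∀ n, μ n (designsIn N E)ᶜ = 0 := by
    intro n
    induction n with
    | zero => rw [hμ0]; exact (prob_compl_eq_zero_iff hS).2 hη
    | succ n ih =>
      rw [hμs, Measure.bind_apply hS.compl (Kernel.aemeasurable _)]
      have h0 : ∀ᵐ X ∂(μ n), X ∈ designsIn N E := ih
      rw [lintegral_congr_ae (h0.mono fun X hX => stepKernel_designsIn hN hE hγ V _ _ hX)]
      simp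
  have hπS : ∀ n, π n (designsIn N E)ᶜ = 0 := fun n => by
    rw [hπ]
    simp [gibbsLaw, gibbsMeasure_compl_designsIn hE]
  obtain ⟨κ, hκ0, hκ1, hκ⟩ :=
    exists_minorization_rate hN hE_bdd hE hE_pos hγ hV hτmin hτ hβ0 hβm
  set a : ℝ := N * osc N E / C with ha
  have ha0 : 0 ≤ a := by positivity
  have ha1 : a < 1 := (div_lt_one hC0).2 hC
  -- The shift by `N` reflects the use of `β (n + N)` in the minorization of the block starting at
  -- `n`.
  set e : ℕ → ℝ := fun n => κ * ((n : ℝ) + Real.exp 1 + N) ^ (-a) with he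
  set s : ℕ → ℝ := fun n => a / ((n : ℝ) + Real.exp 1) with hs
  have hexp : 1 < Real.exp 1 := Real.one_lt_exp_iff.2 one_pos
  have he0 : ∀ n, 0 ≤ e n := fun n => by positivity
  have he1 : ∀ n, e n ≤ 1 := fun n => by
    have hn : (0 : ℝ) ≤ n := Nat.cast_nonneg n
    exact mul_le_one₀ hκ1 (by positivity)
      (Real.rpow_le_one_of_one_le_of_nonpos (by linarith) (by linarith))
  have hs0 : ∀ n, 0 ≤ s n := fun n => by positivity
  have hstep : ∀ n t, 0 ≤ t → HasOverlap (μ n) (π n) t →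
      HasOverlap (μ (n + N)) (π (n + N)) ((1 - e n) * t + s n) := by
    intro n t ht h
    obtain ⟨ρ, hρ1, hρ2⟩ := hκ n
    rw [hβ, exp_neg_logSchedule] at hρ1
    have hle := bind_blockKernel_le (b := fun n => β n * osc N E) hπinv (fun n => by
      rw [← sub_mul]
      exact gibbsLaw_le_smul hN hE_bdd hE hE_pos (hβ0 n) (hβm n.le_succ)) n N
    rw [← bind_blockKernel hμs n N]
    refine h.bind _ (hμS n) (hπS n) hρ2 (he0 n) (he1 n) ?_ (hs0 n) (hle.trans ?_)
    · convert! hρ1 using 4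
      push_cast; ring
    · refine Measure.le_iff.2 fun A _ => ?_
      rw [Measure.smul_apply, Measure.smul_apply]
      refine mul_le_mul_left (ENNReal.ofReal_le_ofReal (Real.exp_le_exp.2 ?_)) _
      rw [← sub_mul, hβ, hβ]
      calc _ ≤ N / C / ((n : ℝ) + Real.exp 1) * osc N E := by
            gcongr
            exact logSchedule_sub_le hC0 n N
        _ = s n := by rw [hs, ha]; ring
  have hmain : Tendsto (fun n => μ n (nearOptimal N E ε)) atTop (𝓝 1) := by
    -- The overlap recursion advances by `N` iterations, so each residue class modulo `N` is treated
    -- separately.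
    refine tendsto_of_tendsto_residues (N := N) (by omega) fun r hr => ?_
    have hsub : Tendsto (fun k : ℕ => r + k * N) atTop atTop :=
      tendsto_atTop_mono (fun k => (Nat.le_mul_of_pos_right k (by omega)).trans
        (Nat.le_add_left _ r)) tendsto_id
    obtain ⟨u, hu, hov⟩ := exists_overlap_rate he1 hs0 hstep
      (tendsto_sum_rpow_neg ha1.le hκ0 hr) (fun δ hδ => by
        have h1 := (tendsto_atTop_add_const_right _ (Real.exp 1)
          tendsto_natCast_atTop_atTop).comp hsub
        exact h1.eventually (eventually_div_le_rpow_neg ha0 ha1 hκ0 hδ))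
    exact tendsto_one_of_overlap hu hov (measurableSet_nearOptimal hE ε)
      ((tendsto_gibbsLaw_compl_nearOptimal hE_bdd hE hE_pos hβ0 hβt hε).comp hsub)
  refine hmain.congr fun n => ?_
  exact Measure.map_apply (measurable_pi_apply n) (measurableSet_nearOptimal hE ε)

end Convergence

end MaximinAnnealing

theorem mainTheorem6 {d N : ℕ} (hN : 2 ≤ N)
    (E : Set (MaximinAnnealing.Point d)) (hE_bdd : Bornology.IsBounded E)
    (hE : MeasurableSet E) (hE_pos : 0 < volume E)
    (γ : ℝ) (hγ : 0 < γ)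
    (V : Matrix (Fin d) (Fin d) ℝ) (hV : V.PosDef)
    (τ : ℕ → ℝ) (τmin : ℝ) (hτmin : 0 < τmin) (hτ : ∀ n, τ n ≤ τ 0 ∧ τmin ≤ τ n)
    (C : ℝ) (hC : (N : ℝ) * MaximinAnnealing.osc N E < C)
    (β : ℕ → ℝ) (hβ : ∀ n : ℕ, β n = 1 / C * Real.log ((n : ℝ) + Real.exp 1))
    (η : Measure (MaximinAnnealing.Design d N)) [IsProbabilityMeasure η]
    (hη : η (MaximinAnnealing.designsIn N E) = 1) :
    ∀ ε : ℝ, 0 < ε →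
      Tendsto
        (fun n : ℕ => MaximinAnnealing.sequenceLaw hN hE hγ V β τ η
          {X | X n ∈ MaximinAnnealing.nearOptimal N E ε})
        atTop (𝓝 1) :=
  MaximinAnnealing.tendsto_sequenceLaw_nearOptimal hN E hE_bdd hE hE_pos γ hγ V hV τ τmin
    hτmin hτ C hC β hβ η hη
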